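/- Let $0<\mu<\overline v$. A seller offers one item to two bidders whose values are drawn i.i.d. from a distribution $F$ on $\mathbb R$. Let $\mathcal F$ be the set of probability distributions with mean $\mu$ and support contained in $[0,\overline v]$. Let $\mathcal M$ be the set of truthful mechanisms, that is, of (measurable) allocation rules $x$ and payment rules $p$ on $[0,\overline v]^2$, where, for a bid profile $b$, $x_i(b)\ge 0$ is the probability that bidder $i$ receives the item, $x_1(b)+x_2(b)\le 1$, and $p_i(b)\in\mathbb R$ is the expected payment of bidder $i$, such that for every bidder $i$, every value $v_i$, every bid $b_j$ of the other bidder and every misreport $d$ (all in $[0,\overline v]$) $$v_i\,x_i(v_i,b_j)-p_i(v_i,b_j)\ \ge\ v_i\,x_i(d,b_j)-p_i(d,b_j)\quad\text{and}\quad v_i\,x_i(v_i,b_j)-p_i(v_i,b_j)\ \ge\ 0 .$$ For $M=(x,p)\in\mathcal M$ and $F\in\mathcal F$ let $\mathrm{Rev}_F(M)=\mathbb E_{v_1,v_2\sim F\text{ i.i.d.}}[p_1(v_1,v_2)+p_2(v_1,v_2)]\in[-\infty,\infty)$. Then there is a unique $\underline v\in(0,\overline v]$ with $\underline v\,(1+\log\overline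 v-\log\underline v)=\mu$, and for this $\underline v$ the functions $$F^*(v)=\begin{cases}0& v<\underline v,\\ 1-\underline v/v& \underline v\le v<\overline v,\\ 1& v\ge\overline v,\end{cases}\qquad Q^*(r)=\begin{cases}0& r<0,\\ \left(1-\frac{\underline v}{\overline v}\right)\frac{1}{\log\overline v-\log\underline v}& 0\le r\le\underline v,\\ \left(1-\frac{\underline v}{\overline v}\right)\frac{r}{r-\underline v}\cdot\frac{\log r-\log\underline v}{\log\overline v-\log\underline v}&\underline v<r\le\overline v,\\ 1& r>\overline v\end{cases}$$ are the cumulative distribution functions of probability distributions on $[0,\overline v]$. Let $M^*$ be the second-price auction with a random reserve $r$ drawn from $Q^*$: a highest bidder wins if the highest bid strictly exceeds $r$, and pays the maximum of $r$ and the other bid; otherwise the item is not sold; ties are broken by an arbitrary (measurable, possibly randomized) rule. Then, for every tie-breaking rule, $M^*\in\mathcal M$, $F^*\in\mathcal F$, and $(M^*,F^*)$ is an equilibrium of the zero-sum game with payoff $\mathrm{Rev}_F(M)$ to the seller: $$\mathrm{Rev}_{F^*}(M)\ \le\ \mathrm{Rev}_{F^*}(M^*)\ \le\ \mathrm{Rev}_F(M^*)\qquad\text{for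 all }M\in\mathcal M,\ F\in\mathcal F .$$ Consequently $M^*$ maximizes $\inf_{F\in\mathcal F}\mathrm{Rev}_F(M)$ over $M\in\mathcal M$, and $F^*$ minimizes $\sup_{M\in\mathcal M}\mathrm{Rev}_F(M)$ over $F\in\mathcal F$. -/

import Mathlib

open MeasureTheory ProbabilityTheory

noncomputable section

namespace RobustAuction

/-- A direct (possibly randomized) single-item mechanism for two bidders: `alloc b i` is the
probability that bidder `i` receives the item and `pay b i` is the expected payment of bidder `i`,
both over the internal randomness of the mechanism, when the profile of bids is `b`. -/
structure Mechanism where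
  alloc : (Fin 2 → ℝ) → Fin 2 → ℝ
  pay : (Fin 2 → ℝ) → Fin 2 → ℝ

/-- The profiles of values (or bids) in `[0, vbar]`. -/
def profiles (vbar : ℝ) : Set (Fin 2 → ℝ) :=
  {b | ∀ i, b i ∈ Set.Icc 0 vbar}

/-- Expected quasi-linear utility of bidder `i` with value `v` when the bids are `b`. -/
def Mechanism.utility (M : Mechanism) (i : Fin 2) (v : ℝ) (b : Fin 2 → ℝ) : ℝ :=
  v * M.alloc b i - M.pay b i

/-- The design space: measurable mechanisms that are feasible (the item is allocated at most once),
dominant-strategy incentive compatible and individually rational, where values and bids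
range over `[0, vbar]`. -/
structure Mechanism.IsTruthful (M : Mechanism) (vbar : ℝ) : Prop where
  measurable_alloc : Measurable M.alloc
  measurable_pay : Measurable M.pay
  alloc_nonneg : ∀ b ∈ profiles vbar, ∀ i, 0 ≤ M.alloc b i
  alloc_sum_le_one : ∀ b ∈ profiles vbar, ∑ i, M.alloc b i ≤ 1
  /-- Whatever the other bidder reports, reporting the value `b i` is optimal for bidder `i`. -/
  incentive_compatible : ∀ b ∈ profiles vbar, ∀ i, ∀ d ∈ Set.Icc 0 vbar,
    M.utility i (b i) (Function.update b i d) ≤ M.utility i (b i) b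
  individually_rational : ∀ b ∈ profiles vbar, ∀ i, 0 ≤ M.utility i (b i) b

/-- The set of truthful mechanisms for values in `[0, vbar]`. -/
def truthfulMechanisms (vbar : ℝ) : Set Mechanism :=
  {M | M.IsTruthful vbar}

/-- The probability distributions with support in `[0, vbar]`. -/
def supportedDistributions (vbar : ℝ) : Set (ProbabilityMeasure ℝ) :=
  {F | (F : Measure ℝ) (Set.Icc 0 vbar)ᶜ = 0}

/-- The probability distributions with support in `[0, vbar]` and mean `m`. -/
def compatibleDistributions (m vbar : ℝ) : Set (ProbabilityMeasure ℝ) :=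
  {F | F ∈ supportedDistributions vbar ∧ ∫ v, v ∂(F : Measure ℝ) = m}

/-- Expected revenue of `M` when the two values are i.i.d. from `F`. It is the expectation of the
positive part minus that of the negative part: the payments of a truthful mechanism are bounded
above by the values but need not be bounded below, so that the expectation always exists in
`[-∞, ∞)`, but may be `-∞`. -/
def revenue (F : ProbabilityMeasure ℝ) (M : Mechanism) : EReal :=
  ((∫⁻ v, ENNReal.ofReal (∑ i, M.pay v i) ∂(Measure.pi fun _ : Fin 2 => (F : Measure ℝ)) :
      ENNReal) : EReal)
  - ((∫⁻ v, ENNReal.ofReal (-∑ i, M.pay v i) ∂(Measure.pi fun _ : Fin 2 => (F : Measure ℝ)) :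
      ENNReal) : EReal)

/-- A (possibly randomized) tie-breaking rule: `tie i r x` is the probability that bidder `i` wins
when both bidders bid `x` and the reserve price `r` is cleared. -/
structure IsTieBreaking (tie : Fin 2 → ℝ → ℝ → ℝ) : Prop where
  measurable : ∀ i, Measurable (Function.uncurry (tie i))
  nonneg : ∀ i r x, 0 ≤ tie i r x
  sum_eq_one : ∀ r x, ∑ i, tie i r x = 1

/-- Probability that bidder `i` wins the second-price auction with fixed reserve `r`: a highest
bidder wins if the highest bid strictly exceeds `r`. The other bidder is `1 - i`. -/
def secondPriceAlloc (tie : Fin 2 → ℝ → ℝ → ℝ) (r : ℝ) (b : Fin 2 → ℝ) (i : Fin 2) : ℝ :=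
  if r < b i then
    if b (1 - i) < b i then 1
    else if b i < b (1 - i) then 0
    else tie i r (b i)
  else 0

/-- Expected payment of bidder `i` in the second-price auction with fixed reserve `r`: the winner
pays the maximum of the reserve and the other bid. -/
def secondPricePay (tie : Fin 2 → ℝ → ℝ → ℝ) (r : ℝ) (b : Fin 2 → ℝ) (i : Fin 2) : ℝ :=
  secondPriceAlloc tie r b i * max r (b (1 - i))

/-- The second-price auction with a random reserve drawn from `Q`. -/
def secondPriceRandomReserve (tie : Fin 2 → ℝ → ℝ → ℝ) (Q : ProbabilityMeasure ℝ) : Mechanism where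
  alloc b i := ∫ r, secondPriceAlloc tie r b i ∂(Q : Measure ℝ)
  pay b i := ∫ r, secondPricePay tie r b i ∂(Q : Measure ℝ)

/-- Cumulative distribution function of the equal-revenue distribution on `[vlow, vbar]`. -/
def equalRevenueCDF (vlow vbar v : ℝ) : ℝ :=
  if v < vlow then 0
  else if v < vbar then 1 - vlow / v
  else 1

/-- Cumulative distribution function of the seller's random reserve. -/
def reserveCDF (vlow vbar r : ℝ) : ℝ :=
  if r < 0 then 0
  else if r ≤ vlow then (1 - vlow / vbar) * (1 / (Real.log vbar - Real.log vlow))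
  else if r ≤ vbar then
    (1 - vlow / vbar) * (r / (r - vlow)) *
      ((Real.log r - Real.log vlow) / (Real.log vbar - Real.log vlow))
  else 1

/-- The pair `(M, F)` is a (pure) equilibrium, i.e. a saddle point, of the zero-sum game in which
the seller picks a truthful mechanism, the adversary picks a compatible distribution, and the
payoff of the seller is the expected revenue. -/
structure IsEquilibrium (m vbar : ℝ) (M : Mechanism) (F : ProbabilityMeasure ℝ) : Prop where
  mechanism_mem : M ∈ truthfulMechanisms vbar
  distribution_mem : F ∈ compatibleDistributions m vbar
  seller_optimal : ∀ M' ∈ truthfulMechanisms vbar, revenue F M' ≤ revenue F M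
  adversary_optimal : ∀ F' ∈ compatibleDistributions m vbar, revenue F M ≤ revenue F' M

end RobustAuction

end

noncomputable section

/-! Write `a` for the lower end of the equal-revenue distribution, `b` for the upper bound on values
and `C` for the mass of the random reserve at 0. Both sides of the saddle point meet at the value `2
* a - a ^ 2 / b`.

Seller's side. Fix the other bid and let `u` be the utility of a truthful bidder with allocation `x`
and payment `t`. Then `u` is convex with subgradient `x`, so the derivative of `u v / v` is `t v / v
^ 2` almost everywhere. Under the density `a / v ^ 2` the expected payment therefore telescopes; the
atom at `b` cancels the upper boundary term, and the expectation is at most `a * x b`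
(`integral_pay_equalRevenueMeasure_le`). Only the allocation to the top type matters. Summed over
the bidders, it is limited by feasibility when both have value `b`, an event whose conditional
probability, given that one bidder has value `b`, is `a / b`.

Adversary's side. At reserve `r` the auction earns `r` if the highest bid exceeds `r`, plus the
excess of the lowest bid over `r`. Integrating over the reserve turns revenue into an integral over
price levels `x` of an expression affine in each indicator that a value exceeds `x`. For i.i.d.
values with tail `s`, independence gives the integrand `x * q * (2 * s - s ^ 2) + Q * s ^ 2`, where
`Q` and `q` are the distribution function and density of the reserve. The mean constraint fixes the
integral of `s`. With multiplier `2 * C` the Lagrangian is minimized level by level: it is a convex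
quadratic in `s`, and `Q` is built so that its first-order condition holds at the equal-revenue tail
(`reserve_first_order`, `levelRevenue_tail_equalRevenueMeasure_le`).

An explicit antiderivative evaluates the auction's revenue at the equal-revenue distribution and
shows that it attains the seller's bound. -/

namespace RobustAuction

/-! ### Measures with one atom and a density -/

/-- The measure with an atom of mass `c` at `y` and density `f` on `(a, b]`. -/
def atomPlusDensity (c y a b : ℝ) (f : ℝ → ℝ) : Measure ℝ :=
  ENNReal.ofReal c • Measure.dirac y +
    (volume.restrict (Set.Ioc a b)).withDensity fun x => ENNReal.ofReal (f x)

section AtomPlusDensity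

variable {c y a b : ℝ} {f G : ℝ → ℝ}

/-- Clamping `r` to `[a, b]` treats all positions of `r` at once. Differentiability is asked only in
the open interval, since the reserve density is a quotient 0/0 at `a`; integrability of `f` follows
from its sign and the continuity of `G`. -/
lemma setLIntegral_Iic_of_hasDerivAt (hab : a ≤ b) (hG : ContinuousOn G (Set.Icc a b))
    (hd : ∀ x ∈ Set.Ioo a b, HasDerivAt G (f x) x) (hf : ∀ x ∈ Set.Ioc a b, 0 ≤ f x) (r : ℝ) :
    ∫⁻ x in Set.Iic r, ENNReal.ofReal (f x) ∂(volume.restrict (Set.Ioc a b)) =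
      ENNReal.ofReal (G (max a (min r b)) - G a) := by
  have hint : IntegrableOn f (Set.Ioc a b) :=
    intervalIntegral.integrableOn_deriv_of_nonneg hG hd fun x hx => hf x ⟨hx.1, hx.2.le⟩
  set z := max a (min r b) with hz
  have haz : a ≤ z := le_max_left _ _
  have hzb : z ≤ b := max_le hab (min_le_right _ _)
  have hset : Set.Iic r ∩ Set.Ioc a b = Set.Ioc a z := by
    ext x
    simp only [Set.mem_inter_iff, Set.mem_Iic, Set.mem_Ioc, hz, le_max_iff, le_min_iff]
    constructor
    · rintro ⟨h1, h2, h3⟩; exact ⟨h2, Or.inr ⟨h1, h3⟩⟩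
    · rintro ⟨h1, h2 | h2⟩
      · exact absurd h1 (not_lt.2 h2)
      · exact ⟨h2.1, h1, h2.2⟩
  have hi : IntegrableOn f (Set.Ioc a z) := hint.mono_set (Set.Ioc_subset_Ioc_right hzb)
  rw [Measure.restrict_restrict measurableSet_Iic, hset, ← ofReal_integral_eq_lintegral_ofReal hi,
    ← intervalIntegral.integral_of_le haz,
    intervalIntegral.integral_eq_sub_of_hasDerivAt_of_le haz
      (hG.mono (Set.Icc_subset_Icc_right hzb))
      (fun x hx => hd x ⟨hx.1, hx.2.trans_le hzb⟩)
      ((intervalIntegrable_iff_integrableOn_Ioc_of_le haz).2 hi)]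
  filter_upwards [ae_restrict_mem measurableSet_Ioc] with x hx
  exact hf x ⟨hx.1, hx.2.trans hzb⟩

lemma atomPlusDensity_Iic (hab : a ≤ b) (hG : ContinuousOn G (Set.Icc a b))
    (hd : ∀ x ∈ Set.Ioo a b, HasDerivAt G (f x) x) (hf : ∀ x ∈ Set.Ioc a b, 0 ≤ f x) (r : ℝ) :
    atomPlusDensity c y a b f (Set.Iic r) =
      ENNReal.ofReal c * (Set.Iic r).indicator 1 y
        + ENNReal.ofReal (G (max a (min r b)) - G a) := by
  rw [atomPlusDensity, Measure.add_apply, withDensity_apply _ measurableSet_Iic,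
    setLIntegral_Iic_of_hasDerivAt hab hG hd hf, Measure.smul_apply,
    Measure.dirac_apply' _ measurableSet_Iic, smul_eq_mul]

lemma atomPlusDensity_univ (hab : a ≤ b) (hG : ContinuousOn G (Set.Icc a b))
    (hd : ∀ x ∈ Set.Ioo a b, HasDerivAt G (f x) x) (hf : ∀ x ∈ Set.Ioc a b, 0 ≤ f x) :
    atomPlusDensity c y a b f Set.univ =
      ENNReal.ofReal c + ENNReal.ofReal (G b - G a) := by
  have h := setLIntegral_Iic_of_hasDerivAt hab hG hd hf b
  rw [min_self, max_eq_right hab, Measure.restrict_restrict measurableSet_Iic,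
    Set.inter_eq_right.2 Set.Ioc_subset_Iic_self] at h
  rw [atomPlusDensity, Measure.add_apply, withDensity_apply _ MeasurableSet.univ,
    Measure.restrict_univ, h]
  simp

lemma isProbabilityMeasure_atomPlusDensity (hab : a ≤ b) (hG : ContinuousOn G (Set.Icc a b))
    (hd : ∀ x ∈ Set.Ioo a b, HasDerivAt G (f x) x) (hf : ∀ x ∈ Set.Ioc a b, 0 ≤ f x)
    (hc : 0 ≤ c) (hmass : c + (G b - G a) = 1) :
    IsProbabilityMeasure (atomPlusDensity c y a b f) := by
  have hmono : G a ≤ G b := by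
    refine monotoneOn_of_deriv_nonneg (convex_Icc a b) hG ?_ ?_ (Set.left_mem_Icc.2 hab)
      (Set.right_mem_Icc.2 hab) hab
    · rw [interior_Icc]
      exact fun x hx => (hd x hx).differentiableAt.differentiableWithinAt
    · rw [interior_Icc]
      exact fun x hx => (hd x hx).deriv ▸ hf x ⟨hx.1, hx.2.le⟩
  constructor
  rw [atomPlusDensity_univ hab hG hd hf, ← ENNReal.ofReal_add hc (sub_nonneg.2 hmono), hmass,
    ENNReal.ofReal_one]

lemma ae_atomPlusDensity_of_forall {p : ℝ → Prop} (hp : MeasurableSet {x | p x}) (hy : p y)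
    (h : ∀ x ∈ Set.Ioc a b, p x) : ∀ᵐ x ∂(atomPlusDensity c y a b f), p x := by
  rw [atomPlusDensity, ae_add_measure_iff]
  constructor
  · exact Measure.ae_smul_measure ((ae_dirac_iff hp).2 hy) _
  · apply (withDensity_absolutelyContinuous _ _).ae_le
    exact ae_restrict_of_forall_mem measurableSet_Ioc h

lemma integral_atomPlusDensity (hc : 0 ≤ c) (hfm : Measurable f)
    (hf : ∀ x ∈ Set.Ioc a b, 0 ≤ f x) {g : ℝ → ℝ}
    (hg : Integrable g (atomPlusDensity c y a b f)) :
    IntegrableOn (fun x => f x * g x) (Set.Ioc a b) ∧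
    ∫ x, g x ∂(atomPlusDensity c y a b f) = c * g y + ∫ x in Set.Ioc a b, f x * g x := by
  have h1 := hg
  rw [atomPlusDensity, integrable_add_measure] at h1
  have hae : ∀ᵐ x ∂(volume.restrict (Set.Ioc a b)),
      (ENNReal.ofReal (f x)).toReal • g x = f x * g x := by
    filter_upwards [ae_restrict_mem measurableSet_Ioc] with x hx
    rw [ENNReal.toReal_ofReal (hf x hx), smul_eq_mul]
  refine ⟨?_, ?_⟩
  · exact ((integrable_withDensity_iff_integrable_smul' hfm.ennreal_ofReal
      (Filter.Eventually.of_forall fun _ => ENNReal.ofReal_lt_top)).1 h1.2).congr hae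
  · rw [atomPlusDensity, integral_add_measure h1.1 h1.2, integral_smul_measure, integral_dirac,
      integral_withDensity_eq_integral_toReal_smul hfm.ennreal_ofReal
        (Filter.Eventually.of_forall fun _ => ENNReal.ofReal_lt_top), integral_congr_ae hae,
      ENNReal.toReal_ofReal hc, smul_eq_mul]

end AtomPlusDensity

/-! ### The equal-revenue distribution and the distribution of the reserve -/

/-- Density of the continuous part of the equal-revenue distribution. -/
def equalRevenueDensity (a x : ℝ) : ℝ := a / x ^ 2

/-- The equal-revenue distribution on `[a, b]`. -/
def equalRevenueMeasure (a b : ℝ) : Measure ℝ :=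
  atomPlusDensity (a / b) b a b (equalRevenueDensity a)

/-- Mass at zero of the random reserve. -/
def reserveAtom (a b : ℝ) : ℝ := (1 - a / b) / (Real.log b - Real.log a)

/-- Density of the continuous part of the random reserve. -/
def reserveDensity (a b x : ℝ) : ℝ :=
  reserveAtom a b * (((x - a) - a * (Real.log x - Real.log a)) / (x - a) ^ 2)

/-- The continuous branch of the distribution function of the random reserve. -/
def reserveBranch (a b x : ℝ) : ℝ := reserveAtom a b * x * dslope Real.log a x

/-- The distribution of the random reserve. -/
def reserveMeasure (a b : ℝ) : Measure ℝ :=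
  atomPlusDensity (reserveAtom a b) 0 a b (reserveDensity a b)

section Distributions

variable {a b : ℝ}

lemma measurable_equalRevenueDensity : Measurable (equalRevenueDensity a) := by
  unfold equalRevenueDensity; fun_prop

lemma measurable_reserveDensity : Measurable (reserveDensity a b) := by
  unfold reserveDensity; fun_prop

lemma equalRevenueDensity_nonneg (ha : 0 < a) (x : ℝ) : 0 ≤ equalRevenueDensity a x := by
  unfold equalRevenueDensity; positivity

lemma continuousOn_one_sub_div (ha : 0 < a) :
    ContinuousOn (fun x : ℝ => 1 - a / x) (Set.Icc a b) :=
  continuousOn_const.sub (continuousOn_const.div continuousOn_id fun _ hx => (ha.trans_le hx.1).ne')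

lemma hasDerivAt_one_sub_div (ha : 0 < a) {x : ℝ} (hx : a < x) :
    HasDerivAt (fun x : ℝ => 1 - a / x) (equalRevenueDensity a x) x := by
  have hx0 : x ≠ 0 := (ha.trans hx).ne'
  have := ((hasDerivAt_const x a).div (hasDerivAt_id x) hx0).const_sub 1
  exact this.congr_deriv (by simp [equalRevenueDensity, neg_div])

lemma isProbabilityMeasure_equalRevenueMeasure (ha : 0 < a) (hab : a < b) :
    IsProbabilityMeasure (equalRevenueMeasure a b) := by
  have hb := ha.trans hab
  refine isProbabilityMeasure_atomPlusDensity (G := fun x : ℝ => 1 - a / x) hab.le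
    (continuousOn_one_sub_div ha) (fun x hx => hasDerivAt_one_sub_div ha hx.1)
    (fun x _ => equalRevenueDensity_nonneg ha x) (by positivity) ?_
  field_simp
  ring

lemma cdf_equalRevenueMeasure (ha : 0 < a) (hab : a < b) (v : ℝ) :
    cdf (equalRevenueMeasure a b) v = equalRevenueCDF a b v := by
  have := isProbabilityMeasure_equalRevenueMeasure ha hab
  have hb := ha.trans hab
  have hba : a / b ≤ 1 := (div_le_one hb).2 hab.le
  rw [cdf_eq_real, measureReal_def, equalRevenueMeasure,
    atomPlusDensity_Iic (G := fun x : ℝ => 1 - a / x) hab.le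
    (continuousOn_one_sub_div ha) (fun x hx => hasDerivAt_one_sub_div ha hx.1)
    (fun x _ => equalRevenueDensity_nonneg ha x), equalRevenueCDF]
  split_ifs with h1 h2
  · have : b ∉ Set.Iic v := by simp; linarith
    rw [Set.indicator_of_notMem this, min_eq_left (h1.le.trans hab.le), max_eq_left h1.le]
    simp
  · have : b ∉ Set.Iic v := by simpa using h2
    push Not at h1
    rw [Set.indicator_of_notMem this, min_eq_left h2.le, max_eq_right h1, div_self ha.ne']
    have : a / v ≤ 1 := (div_le_one (ha.trans_le h1)).2 h1
    simp [this]
  · have : b ∈ Set.Iic v := by simpa using h2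
    push Not at h2
    rw [Set.indicator_of_mem this, min_eq_right h2, max_eq_right hab.le, div_self ha.ne',
      Pi.one_apply, mul_one, ← ENNReal.ofReal_add (by positivity) (by linarith),
      ENNReal.toReal_ofReal (by linarith)]
    ring

lemma log_sub_log_pos (ha : 0 < a) (hab : a < b) : 0 < Real.log b - Real.log a :=
  sub_pos.2 (Real.log_lt_log ha hab)

lemma reserveAtom_nonneg (ha : 0 < a) (hab : a < b) : 0 ≤ reserveAtom a b :=
  div_nonneg (sub_nonneg.2 ((div_le_one (ha.trans hab)).2 hab.le)) (log_sub_log_pos ha hab).le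

/-- The inequality `log t ≤ t - 1` at `t = x / a`; it makes the reserve density nonnegative. -/
lemma mul_log_sub_log_le (ha : 0 < a) {x : ℝ} (hx : a < x) :
    a * (Real.log x - Real.log a) ≤ x - a := by
  have hx0 := ha.trans hx
  have := Real.log_le_sub_one_of_pos (div_pos hx0 ha)
  rw [Real.log_div hx0.ne' ha.ne'] at this
  calc a * (Real.log x - Real.log a) ≤ a * (x / a - 1) := by gcongr
    _ = x - a := by field_simp

lemma reserveDensity_nonneg (ha : 0 < a) (hab : a < b) {x : ℝ} (hx : a < x) :
    0 ≤ reserveDensity a b x :=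
  mul_nonneg (reserveAtom_nonneg ha hab)
    (div_nonneg (sub_nonneg.2 (mul_log_sub_log_le ha hx)) (sq_nonneg _))

/-- The quotient `(log x - log a) / (x - a)` has a removable singularity at `a`, which `dslope`
fills with the derivative `1 / a`. The branch thus starts at the mass of the atom, and the
distribution function is continuous at `a`. -/
lemma continuousOn_reserveBranch (ha : 0 < a) : ContinuousOn (reserveBranch a b) (Set.Icc a b) := by
  have h : ContinuousOn (dslope Real.log a) (Set.Ioi 0) :=
    (continuousOn_dslope (Ioi_mem_nhds ha)).2
      ⟨Real.continuousOn_log.mono fun x hx => ne_of_gt hx, Real.differentiableAt_log ha.ne'⟩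
  exact (continuousOn_const.mul continuousOn_id).mul (h.mono fun x hx => ha.trans_le hx.1)

lemma reserveBranch_of_lt {x : ℝ} (hx : a < x) :
    reserveBranch a b x =
      reserveAtom a b * (x / (x - a)) * (Real.log x - Real.log a) := by
  rw [reserveBranch, dslope_of_ne _ hx.ne', slope_def_field]
  ring

lemma reserveBranch_left (ha : 0 < a) : reserveBranch a b a = reserveAtom a b := by
  rw [reserveBranch, dslope_same, Real.deriv_log, mul_assoc, mul_inv_cancel₀ ha.ne', mul_one]

lemma reserveBranch_right (ha : 0 < a) (hab : a < b) : reserveBranch a b b = 1 := by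
  have hb := ha.trans hab
  have := (log_sub_log_pos ha hab).ne'
  have h2 : b - a ≠ 0 := (sub_pos.2 hab).ne'
  rw [reserveBranch_of_lt hab, reserveAtom]
  field_simp

lemma hasDerivAt_reserveBranch (ha : 0 < a) {x : ℝ} (hx : a < x) :
    HasDerivAt (reserveBranch a b) (reserveDensity a b x) x := by
  have hx0 : x ≠ 0 := (ha.trans hx).ne'
  have hxa : x - a ≠ 0 := (sub_pos.2 hx).ne'
  have h := ((hasDerivAt_id x).div ((hasDerivAt_id x).sub_const a) hxa).const_mul
    (reserveAtom a b) |>.mul ((Real.hasDerivAt_log hx0).sub_const (Real.log a))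
  have h2 : HasDerivAt (fun x => reserveAtom a b * (x / (x - a)) * (Real.log x - Real.log a))
      (reserveDensity a b x) x := by
    refine h.congr_deriv ?_
    simp only [reserveDensity, Pi.div_apply, id]
    field_simp
    ring
  refine h2.congr_of_eventuallyEq ?_
  filter_upwards [Ioi_mem_nhds hx] with z hz
  exact reserveBranch_of_lt hz

lemma isProbabilityMeasure_reserveMeasure (ha : 0 < a) (hab : a < b) :
    IsProbabilityMeasure (reserveMeasure a b) := by
  refine isProbabilityMeasure_atomPlusDensity (G := reserveBranch a b) hab.le
    (continuousOn_reserveBranch ha) (fun x hx => hasDerivAt_reserveBranch ha hx.1)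
    (fun x hx => reserveDensity_nonneg ha hab hx.1) (reserveAtom_nonneg ha hab) ?_
  rw [reserveBranch_left ha, reserveBranch_right ha hab]
  ring

lemma reserveBranch_monotoneOn (ha : 0 < a) (hab : a < b) :
    MonotoneOn (reserveBranch a b) (Set.Icc a b) := by
  refine monotoneOn_of_deriv_nonneg (convex_Icc a b) (continuousOn_reserveBranch ha) ?_ ?_
  · rw [interior_Icc]
    exact fun x hx => (hasDerivAt_reserveBranch ha hx.1).differentiableAt.differentiableWithinAt
  · rw [interior_Icc]
    exact fun x hx =>
      (hasDerivAt_reserveBranch (b := b) ha hx.1).deriv ▸ reserveDensity_nonneg ha hab hx.1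

lemma reserveCDF_of_mem (ha : 0 < a) {x : ℝ} (hx : x ∈ Set.Icc a b) :
    reserveCDF a b x = reserveBranch a b x := by
  rw [reserveCDF, if_neg (not_lt.2 (ha.le.trans hx.1))]
  split_ifs with h1 h2
  · rw [le_antisymm h1 hx.1, reserveBranch_left ha, reserveAtom]; ring
  · rw [reserveBranch_of_lt (not_le.1 h1), reserveAtom]; ring
  · exact absurd hx.2 h2

lemma reserveCDF_of_le {x : ℝ} (h0 : 0 ≤ x) (hx : x ≤ a) :
    reserveCDF a b x = reserveAtom a b := by
  rw [reserveCDF, if_neg (not_lt.2 h0), if_pos hx, reserveAtom]; ring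

lemma cdf_reserveMeasure (ha : 0 < a) (hab : a < b) (r : ℝ) :
    cdf (reserveMeasure a b) r = reserveCDF a b r := by
  have := isProbabilityMeasure_reserveMeasure ha hab
  have hC := reserveAtom_nonneg ha hab
  rw [cdf_eq_real, measureReal_def, reserveMeasure,
    atomPlusDensity_Iic (G := reserveBranch a b) hab.le
    (continuousOn_reserveBranch ha) (fun x hx => hasDerivAt_reserveBranch ha hx.1)
    (fun x hx => reserveDensity_nonneg ha hab hx.1)]
  rcases lt_or_ge r 0 with h0 | h0
  · have : (0 : ℝ) ∉ Set.Iic r := by simpa using h0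
    rw [Set.indicator_of_notMem this, min_eq_left (by linarith), max_eq_left (by linarith),
      reserveCDF, if_pos h0]
    simp
  have : (0 : ℝ) ∈ Set.Iic r := h0
  rw [Set.indicator_of_mem this, Pi.one_apply, mul_one]
  have hz : max a (min r b) ∈ Set.Icc a b :=
    ⟨le_max_left _ _, max_le hab.le (min_le_right _ _)⟩
  have hm := reserveBranch_monotoneOn ha hab (Set.left_mem_Icc.2 hab.le) hz hz.1
  rw [← ENNReal.ofReal_add hC (sub_nonneg.2 hm), ENNReal.toReal_ofReal (by linarith),
    reserveBranch_left ha, add_sub_cancel]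
  rcases le_or_gt r a with h1 | h1
  · rw [min_eq_left (h1.trans hab.le), max_eq_left h1, reserveBranch_left ha,
      reserveCDF_of_le h0 h1]
  rcases le_or_gt r b with h2 | h2
  · rw [min_eq_left h2, max_eq_right h1.le, reserveCDF_of_mem ha ⟨h1.le, h2⟩]
  · rw [min_eq_right h2.le, max_eq_right hab.le, reserveBranch_right ha hab, reserveCDF,
      if_neg (not_lt.2 h0), if_neg (not_le.2 h1), if_neg (not_le.2 h2)]

lemma ae_mem_reserveMeasure (ha : 0 < a) (hab : a < b) :
    ∀ᵐ r ∂(reserveMeasure a b), r ∈ Set.Icc 0 b :=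
  ae_atomPlusDensity_of_forall measurableSet_Icc ⟨le_rfl, (ha.trans hab).le⟩
    fun _ hx => ⟨(ha.trans hx.1).le, hx.2⟩

lemma ae_mem_equalRevenueMeasure (hab : a < b) :
    ∀ᵐ r ∂(equalRevenueMeasure a b), r ∈ Set.Icc a b :=
  ae_atomPlusDensity_of_forall measurableSet_Icc ⟨hab.le, le_rfl⟩ fun _ hx => ⟨hx.1.le, hx.2⟩

lemma integral_id_equalRevenueMeasure (ha : 0 < a) (hab : a < b) :
    ∫ v, v ∂(equalRevenueMeasure a b) = a * (1 + Real.log b - Real.log a) := by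
  have := isProbabilityMeasure_equalRevenueMeasure ha hab
  have hb := ha.trans hab
  have hi : Integrable (fun v : ℝ => v) (equalRevenueMeasure a b) :=
    Integrable.of_mem_Icc a b aemeasurable_id (ae_mem_equalRevenueMeasure hab)
  obtain ⟨-, h⟩ := integral_atomPlusDensity (by positivity) measurable_equalRevenueDensity
    (fun x _ => equalRevenueDensity_nonneg ha x) hi
  rw [equalRevenueMeasure, h, ← intervalIntegral.integral_of_le hab.le,
    intervalIntegral.integral_congr (g := fun x => a * x⁻¹)]
  · rw [intervalIntegral.integral_const_mul, integral_inv_of_pos ha hb,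
      Real.log_div hb.ne' ha.ne']
    field_simp
    ring
  · intro x hx
    rw [Set.uIcc_of_le hab.le] at hx
    have : x ≠ 0 := (ha.trans_le hx.1).ne'
    simp only [equalRevenueDensity]
    field_simp

end Distributions

/-! ### Bounding the seller against the equal-revenue distribution -/

/-- Against the equal-revenue distribution, the revenue of a truthful mechanism for a single bidder
is at most `a` times the probability of serving the highest type. -/
lemma integral_pay_equalRevenueMeasure_le {a b : ℝ} (ha : 0 < a) (hab : a < b) {x t : ℝ → ℝ}
    (ht : Measurable t) (hx0 : ∀ v ∈ Set.Icc 0 b, 0 ≤ x v) (hx1 : ∀ v ∈ Set.Icc 0 b, x v ≤ 1)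
    (hIC : ∀ v ∈ Set.Icc 0 b, ∀ d ∈ Set.Icc 0 b, v * x d - t d ≤ v * x v - t v)
    (hIR : ∀ v ∈ Set.Icc 0 b, 0 ≤ v * x v - t v) :
    ∫ v, t v ∂(equalRevenueMeasure a b) ≤ a * x b := by
  have := isProbabilityMeasure_equalRevenueMeasure ha hab
  have hb := ha.trans hab
  have hsub : Set.Icc a b ⊆ Set.Icc 0 b := Set.Icc_subset_Icc_left ha.le
  -- Type 0 must not gain by reporting `v`, so `t v ≥ t 0`; individual rationality gives `t v ≤ b`.
  have hi : Integrable t (equalRevenueMeasure a b) := by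
    refine Integrable.of_mem_Icc (t 0) b ht.aemeasurable ?_
    filter_upwards [ae_mem_equalRevenueMeasure hab] with v hv
    have hv' := hsub hv
    have h1 := hIC 0 ⟨le_rfl, hb.le⟩ v hv'
    have h2 := hIR v hv'
    have h3 := mul_le_mul_of_nonneg_left (hx1 v hv') hv'.1
    exact ⟨by linarith, by linarith [hv.2]⟩
  obtain ⟨hi2, heq⟩ := integral_atomPlusDensity (by positivity) measurable_equalRevenueDensity
    (fun x _ => equalRevenueDensity_nonneg ha x) hi
  set u : ℝ → ℝ := fun v => v * x v - t v with hu
  -- Incentive compatibility says that `x v` is a subgradient of `u` at `v`. Convexity and, as `0 ≤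
  -- x ≤ 1`, the Lipschitz bound follow.
  have hsubgrad : ∀ v ∈ Set.Icc a b, ∀ d ∈ Set.Icc a b, u v + (d - v) * x v ≤ u d := by
    intro v hv d hd
    have := hIC d (hsub hd) v (hsub hv)
    simp only [hu]
    linarith
  have hconv : ConvexOn ℝ (Set.Icc a b) u := by
    refine ⟨convex_Icc a b, fun p hp q hq α β hα hβ hαβ => ?_⟩
    have hc := convex_Icc a b hp hq hα hβ hαβ
    have h1 := mul_le_mul_of_nonneg_left (hsubgrad _ hc p hp) hα
    have h2 := mul_le_mul_of_nonneg_left (hsubgrad _ hc q hq) hβ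
    simp only [smul_eq_mul] at *
    set c := α * p + β * q with hcdef
    have : α * (u c + (p - c) * x c) + β * (u c + (q - c) * x c) = u c := by
      have h3 : α * (u c + (p - c) * x c) + β * (u c + (q - c) * x c)
        = (α + β) * u c + (c - (α + β) * c) * x c := by rw [hcdef]; ring
      rw [h3, hαβ]; ring
    linarith
  have hlip : LipschitzOnWith 1 u (Set.Icc a b) := by
    refine LipschitzOnWith.of_le_add fun p hp q hq => ?_
    have h1 := hsubgrad p hp q hq
    have h2 : (p - q) * x p ≤ |p - q| :=
      (mul_le_mul_of_nonneg_right (le_abs_self _) (hx0 p (hsub hp))).trans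
        (mul_le_of_le_one_right (abs_nonneg _) (hx1 p (hsub hp)))
    rw [Real.dist_eq]
    linarith
  have hcont : ContinuousOn (fun v => a * (u v / v)) (Set.Icc a b) :=
    continuousOn_const.mul
      (hlip.continuousOn.div continuousOn_id fun v hv => (ha.trans_le hv.1).ne')
  -- A convex function has a right derivative at every interior point, and it dominates each
  -- subgradient. This suffices for the one-sided inequality below and avoids almost-everywhere
  -- differentiability.
  have hderiv : ∀ v ∈ Set.Ioo a b,
      HasDerivWithinAt u (derivWithin u (Set.Ioi v) v) (Set.Ioi v) v := fun v hv =>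
    hconv.hasDerivWithinAt_rightDeriv_of_mem_interior (by rwa [interior_Icc])
  have hge : ∀ v ∈ Set.Ioo a b, x v ≤ derivWithin u (Set.Ioi v) v := by
    intro v hv
    have h := (hasDerivWithinAt_iff_tendsto_slope' (by simp)).1 (hderiv v hv)
    refine ge_of_tendsto h ?_
    filter_upwards [Ioo_mem_nhdsGT hv.2] with d hd
    have := hsubgrad v ⟨hv.1.le, hv.2.le⟩ d ⟨(hv.1.trans hd.1).le, hd.2.le⟩
    rw [slope_def_field, le_div_iff₀ (sub_pos.2 hd.1)]
    linarith
  -- The right derivative of `a * (u v / v)` is at least `a * t v / v ^ 2`, the payment weighted by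
  -- the density.
  have hkey := intervalIntegral.integral_le_sub_of_hasDeriv_right_of_le
    (g := fun v => a * (u v / v)) (φ := fun v => equalRevenueDensity a v * t v)
    (g' := fun v => a * ((derivWithin u (Set.Ioi v) v * v - u v * 1) / v ^ 2)) hab.le hcont
    (fun v hv => ((hderiv v hv).div (hasDerivWithinAt_id v _)
      (ha.trans hv.1).ne').const_mul a)
    ((integrableOn_Icc_iff_integrableOn_Ioc enorm_ne_top).2 hi2)
    (fun v hv => by
      have hv0 := ha.trans hv.1
      have h1 := mul_le_mul_of_nonneg_right (hge v hv) hv0.le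
      have h2 : t v ≤ derivWithin u (Set.Ioi v) v * v - u v * 1 := by
        simp only [hu] at h1 ⊢; linarith
      calc equalRevenueDensity a v * t v = a * (t v / v ^ 2) := by
            rw [equalRevenueDensity]; ring
        _ ≤ _ := by gcongr)
  rw [intervalIntegral.integral_of_le hab.le] at hkey
  have hua : 0 ≤ u a := hIR a ⟨ha.le, hab.le⟩
  have e1 : a * (u a / a) = u a := by field_simp
  -- The payment at the atom produces `- a * (u b / b)`, which cancels the upper boundary term of
  -- `hkey`; what remains is `a * x b - u a`.
  have e2 : a / b * t b = a * x b - a * (u b / b) := by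
    simp only [hu]; field_simp; ring
  rw [equalRevenueMeasure, heq, e2]
  simp only [e1] at hkey
  linarith

lemma measurable_vecCons_two : Measurable fun z : ℝ × ℝ => (![z.1, z.2] : Fin 2 → ℝ) :=
  (MeasurableEquiv.finTwoArrow (α := ℝ)).symm.measurable

lemma measurePreserving_vecCons_two (μ : Measure ℝ) [SigmaFinite μ] :
    MeasurePreserving (fun z : ℝ × ℝ => (![z.1, z.2] : Fin 2 → ℝ)) (μ.prod μ)
      (Measure.pi fun _ : Fin 2 => μ) :=
  (measurePreserving_finTwoArrow μ).symm

lemma integral_pi_two (μ : Measure ℝ) [SigmaFinite μ] (g : (Fin 2 → ℝ) → ℝ) :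
    ∫ v, g v ∂(Measure.pi fun _ : Fin 2 => μ) = ∫ z : ℝ × ℝ, g ![z.1, z.2] ∂(μ.prod μ) :=
  ((measurePreserving_finTwoArrow μ).symm.integral_comp' g).symm

lemma ae_pi_two {μ : Measure ℝ} [SigmaFinite μ] {p : ℝ → Prop} (h : ∀ᵐ v ∂μ, p v) :
    ∀ᵐ v ∂(Measure.pi fun _ : Fin 2 => μ), ∀ i, p (v i) :=
  ae_all_iff.2 fun _ => Measure.tendsto_eval_ae_ae.eventually h

lemma revenue_eq_integral {F : ProbabilityMeasure ℝ} {M : Mechanism}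
    (h : Integrable (fun v => ∑ i, M.pay v i) (Measure.pi fun _ : Fin 2 => (F : Measure ℝ))) :
    revenue F M =
      ((∫ v, ∑ i, M.pay v i ∂(Measure.pi fun _ : Fin 2 => (F : Measure ℝ)) : ℝ) : EReal) := by
  rw [integral_eq_lintegral_pos_part_sub_lintegral_neg_part h, revenue, EReal.coe_sub,
    EReal.coe_ennreal_toReal h.lintegral_lt_top.ne,
    EReal.coe_ennreal_toReal (h.neg.lintegral_lt_top (f := fun v => -∑ i, M.pay v i)).ne]

section Truthful

variable {M : Mechanism} {b : ℝ}

lemma mem_profiles_vecCons {p q : ℝ} (hp : p ∈ Set.Icc 0 b) (hq : q ∈ Set.Icc 0 b) :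
    ![p, q] ∈ profiles b := by
  intro i; fin_cases i <;> assumption

lemma Mechanism.IsTruthful.alloc_le_one (hM : M.IsTruthful b) {v : Fin 2 → ℝ}
    (hv : v ∈ profiles b) (i : Fin 2) : M.alloc v i ≤ 1 :=
  (Finset.single_le_sum (fun j _ => hM.alloc_nonneg v hv j) (Finset.mem_univ i)).trans
    (hM.alloc_sum_le_one v hv)

lemma Mechanism.IsTruthful.pay_le (hM : M.IsTruthful b) {v : Fin 2 → ℝ}
    (hv : v ∈ profiles b) (i : Fin 2) : M.pay v i ≤ b := by
  have h1 := hM.individually_rational v hv i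
  have h2 := mul_le_mul_of_nonneg_left (hM.alloc_le_one hv i) (hv i).1
  have h3 := (hv i).2
  rw [Mechanism.utility] at h1
  linarith

lemma Mechanism.IsTruthful.measurable_pay_apply (hM : M.IsTruthful b) (i : Fin 2) :
    Measurable fun v => M.pay v i :=
  (measurable_pi_apply i).comp hM.measurable_pay

lemma Mechanism.IsTruthful.measurable_alloc_apply (hM : M.IsTruthful b) (i : Fin 2) :
    Measurable fun v => M.alloc v i :=
  (measurable_pi_apply i).comp hM.measurable_alloc

/-- Payments are bounded above by `b` but not below. Each is the total minus the other payment,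
hence at least the total minus `b`. -/
lemma Mechanism.IsTruthful.integrable_pay (hM : M.IsTruthful b) {F : ProbabilityMeasure ℝ}
    (hF : ∀ᵐ v ∂(F : Measure ℝ), v ∈ Set.Icc 0 b)
    (hS : Integrable (fun v => ∑ i, M.pay v i) (Measure.pi fun _ : Fin 2 => (F : Measure ℝ)))
    (i : Fin 2) :
    Integrable (fun v => M.pay v i) (Measure.pi fun _ : Fin 2 => (F : Measure ℝ)) := by
  refine (hS.norm.add (integrable_const b)).mono' (hM.measurable_pay_apply i).aestronglyMeasurable
    ?_
  filter_upwards [ae_pi_two hF] with v hv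
  have h0 := hM.pay_le hv 0
  have h1 := hM.pay_le hv 1
  have hb : 0 ≤ b := (hv 0).1.trans (hv 0).2
  simp only [Pi.add_apply, Fin.sum_univ_two, Real.norm_eq_abs]
  have h2 := neg_abs_le (M.pay v 0 + M.pay v 1)
  have h3 := abs_nonneg (M.pay v 0 + M.pay v 1)
  fin_cases i
  · exact abs_le.2 ⟨by simp only [Fin.zero_eta]; linarith, by simp only [Fin.zero_eta]; linarith⟩
  · exact abs_le.2 ⟨by simp only [Fin.mk_one]; linarith, by simp only [Fin.mk_one]; linarith⟩

/-- No truthful mechanism extracts more than `2 * a - a ^ 2 / b` from two bidders with values drawn from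
the equal-revenue distribution on `[a, b]`. -/
lemma Mechanism.IsTruthful.revenue_equalRevenueMeasure_le (hM : M.IsTruthful b) {a : ℝ}
    (ha : 0 < a) (hab : a < b) {F : ProbabilityMeasure ℝ}
    (hF : (F : Measure ℝ) = equalRevenueMeasure a b) :
    revenue F M ≤ ((2 * a - a ^ 2 / b : ℝ) : EReal) := by
  have hb := ha.trans hab
  have hFae : ∀ᵐ v ∂(F : Measure ℝ), v ∈ Set.Icc 0 b := by
    rw [hF]
    filter_upwards [ae_mem_equalRevenueMeasure hab] with v hv
    exact ⟨ha.le.trans hv.1, hv.2⟩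
  have hmeas : Measurable fun v => ∑ i, M.pay v i :=
    Finset.measurable_sum _ fun i _ => hM.measurable_pay_apply i
  set P := Measure.pi fun _ : Fin 2 => (F : Measure ℝ) with hP
  have hpos : ∫⁻ v, ENNReal.ofReal (∑ i, M.pay v i) ∂P < ⊤ := by
    calc ∫⁻ v, ENNReal.ofReal (∑ i, M.pay v i) ∂P ≤ ∫⁻ _, ENNReal.ofReal (b + b) ∂P := by
          refine lintegral_mono_ae ?_
          filter_upwards [ae_pi_two hFae] with v hv
          rw [Fin.sum_univ_two]
          exact ENNReal.ofReal_le_ofReal (add_le_add (hM.pay_le hv 0) (hM.pay_le hv 1))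
      _ < ⊤ := by simp
  -- The positive part is finite, so an infinite negative part makes the revenue `⊥`, and the bound
  -- is trivial.
  by_cases hneg : ∫⁻ v, ENNReal.ofReal (-∑ i, M.pay v i) ∂P = ⊤
  · have : revenue F M = ⊥ := by
      rw [revenue, ← hP, hneg, EReal.coe_ennreal_top, sub_eq_add_neg, EReal.neg_top,
        EReal.add_bot]
    rw [this]; exact bot_le
  have hS : Integrable (fun v => ∑ i, M.pay v i) P := by
    refine ⟨hmeas.aestronglyMeasurable, ?_⟩
    rw [hasFiniteIntegral_iff_norm]
    calc ∫⁻ v, ENNReal.ofReal ‖∑ i, M.pay v i‖ ∂P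
        ≤ ∫⁻ v, (ENNReal.ofReal (∑ i, M.pay v i) + ENNReal.ofReal (-∑ i, M.pay v i)) ∂P := by
          refine lintegral_mono fun v => ?_
          rw [Real.norm_eq_abs]
          rcases abs_cases (∑ i, M.pay v i) with h | h
          · rw [h.1]; exact le_self_add
          · rw [h.1]; exact le_add_self
      _ = _ := lintegral_add_left hmeas.ennreal_ofReal _
      _ < ⊤ := ENNReal.add_lt_top.2 ⟨hpos, lt_top_iff_ne_top.2 hneg⟩
  rw [revenue_eq_integral hS, EReal.coe_le_coe_iff]
  have hi := hM.integrable_pay hFae hS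
  -- `V v` is the profile in which bidder `i` has value `v` and the other bid is frozen, which
  -- reduces to the one-bidder bound.
  have hIC : ∀ i : Fin 2, ∀ V : ℝ → Fin 2 → ℝ,
      (∀ v, V v i = v) → (∀ v ∈ Set.Icc 0 b, V v ∈ profiles b) →
      (∀ v d, Function.update (V v) i d = V d) → Measurable V →
      ∫ v, M.pay (V v) i ∂(F : Measure ℝ) ≤ a * M.alloc (V b) i := by
    intro i V hVi hVp hVu hVm
    rw [hF]
    refine integral_pay_equalRevenueMeasure_le (x := fun v => M.alloc (V v) i) ha hab
      ((hM.measurable_pay_apply i).comp hVm) (fun v hv => hM.alloc_nonneg _ (hVp v hv) i)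
      (fun v hv => hM.alloc_le_one (hVp v hv) i) (fun v hv d hd => ?_) (fun v hv => ?_)
    · have := hM.incentive_compatible (V v) (hVp v hv) i d hd
      rwa [hVu, hVi] at this
    · have := hM.individually_rational (V v) (hVp v hv) i
      rwa [hVi] at this
  have hswap : ∀ i : Fin 2, Integrable (fun z : ℝ × ℝ => M.pay ![z.1, z.2] i)
      ((F : Measure ℝ).prod F) := fun i =>
    (measurePreserving_vecCons_two (F : Measure ℝ)).integrable_comp_of_integrable (hi i)
  have hA0 : Measurable fun w => M.alloc ![b, w] 0 :=
    (hM.measurable_alloc_apply 0).comp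
      (measurable_vecCons_two.comp (measurable_const.prodMk measurable_id))
  have hA1 : Measurable fun w => M.alloc ![w, b] 1 :=
    (hM.measurable_alloc_apply 1).comp
      (measurable_vecCons_two.comp (measurable_id.prodMk measurable_const))
  have hbm : b ∈ Set.Icc 0 b := ⟨hb.le, le_rfl⟩
  have hA0i : Integrable (fun w => M.alloc ![b, w] 0) (F : Measure ℝ) := by
    refine Integrable.of_mem_Icc 0 1 hA0.aemeasurable ?_
    filter_upwards [hFae] with w hw
    exact ⟨hM.alloc_nonneg _ (mem_profiles_vecCons hbm hw) 0,
      hM.alloc_le_one (mem_profiles_vecCons hbm hw) 0⟩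
  have hA1i : Integrable (fun w => M.alloc ![w, b] 1) (F : Measure ℝ) := by
    refine Integrable.of_mem_Icc 0 1 hA1.aemeasurable ?_
    filter_upwards [hFae] with w hw
    exact ⟨hM.alloc_nonneg _ (mem_profiles_vecCons hw hbm) 1,
      hM.alloc_le_one (mem_profiles_vecCons hw hbm) 1⟩
  have h0 : ∫ v, M.pay v 0 ∂P ≤ ∫ w, a * M.alloc ![b, w] 0 ∂(F : Measure ℝ) := by
    rw [hP, integral_pi_two, integral_prod_symm _ (hswap 0)]
    refine integral_mono_ae (hswap 0).integral_prod_right (hA0i.const_mul a) ?_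
    filter_upwards [hFae] with w hw
    exact hIC 0 (fun v => ![v, w]) (fun v => rfl) (fun v hv => mem_profiles_vecCons hv hw)
      (fun v d => by ext j; fin_cases j <;> rfl)
      (measurable_vecCons_two.comp (measurable_id.prodMk measurable_const))
  have h1 : ∫ v, M.pay v 1 ∂P ≤ ∫ w, a * M.alloc ![w, b] 1 ∂(F : Measure ℝ) := by
    rw [hP, integral_pi_two, integral_prod _ (hswap 1)]
    refine integral_mono_ae (hswap 1).integral_prod_left (hA1i.const_mul a) ?_
    filter_upwards [hFae] with w hw
    exact hIC 1 (fun v => ![w, v]) (fun v => rfl) (fun v hv => mem_profiles_vecCons hw hv)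
      (fun v d => by ext j; fin_cases j <;> rfl)
      (measurable_vecCons_two.comp (measurable_const.prodMk measurable_id))
  have hatom : ∫ w, (Set.indicator {b} (fun _ => (1 : ℝ)) w) ∂(F : Measure ℝ) = a / b := by
    have := isProbabilityMeasure_equalRevenueMeasure ha hab
    have hind : Integrable (Set.indicator {b} fun _ => (1 : ℝ)) (equalRevenueMeasure a b) :=
      (integrable_const 1).indicator (measurableSet_singleton b)
    rw [hF, equalRevenueMeasure, (integral_atomPlusDensity (by positivity)
      measurable_equalRevenueDensity (fun x _ => equalRevenueDensity_nonneg ha x) hind).2]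
    have : ∫ x in Set.Ioc a b, equalRevenueDensity a x * Set.indicator {b} (fun _ => (1 : ℝ)) x
        = 0 := by
      refine integral_eq_zero_of_ae ?_
      filter_upwards [ae_restrict_of_ae (Measure.ae_ne volume b)] with x hx
      simp [hx]
    rw [this]
    simp
  have hindi : Integrable (Set.indicator {b} fun _ => (1 : ℝ)) (F : Measure ℝ) :=
    (integrable_const 1).indicator (measurableSet_singleton b)
  calc ∫ v, ∑ i, M.pay v i ∂P = ∫ v, M.pay v 0 ∂P + ∫ v, M.pay v 1 ∂P := by
        simp only [Fin.sum_univ_two]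
        exact integral_add (hi 0) (hi 1)
    _ ≤ ∫ w, a * M.alloc ![b, w] 0 ∂(F : Measure ℝ) +
        ∫ w, a * M.alloc ![w, b] 1 ∂(F : Measure ℝ) := add_le_add h0 h1
    _ = ∫ w, (a * M.alloc ![b, w] 0 + a * M.alloc ![w, b] 1) ∂(F : Measure ℝ) :=
        (integral_add (hA0i.const_mul a) (hA1i.const_mul a)).symm
    -- For `w = b` both allocations refer to the same profile `(b, b)` and sum to at most 1; for
    -- other `w` each is bounded by 1 separately.
    _ ≤ ∫ w, (2 * a - a * Set.indicator {b} (fun _ => (1 : ℝ)) w) ∂(F : Measure ℝ) := by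
        refine integral_mono_ae ((hA0i.const_mul a).add (hA1i.const_mul a))
          ((integrable_const _).sub (hindi.const_mul a)) ?_
        filter_upwards [hFae] with w hw
        have e0 := hM.alloc_le_one (mem_profiles_vecCons hbm hw) 0
        have e1 := hM.alloc_le_one (mem_profiles_vecCons hw hbm) 1
        by_cases hwb : w = b
        · subst hwb
          have := hM.alloc_sum_le_one _ (mem_profiles_vecCons hw hw)
          rw [Fin.sum_univ_two] at this
          have := mul_le_mul_of_nonneg_left this ha.le
          simp only [Set.indicator_of_mem, Set.mem_singleton]
          linarith
        · have e0 := mul_le_mul_of_nonneg_left e0 ha.le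
          have e1 := mul_le_mul_of_nonneg_left e1 ha.le
          simp only [Set.mem_singleton_iff, hwb, not_false_eq_true, Set.indicator_of_notMem]
          linarith
    _ = 2 * a - a ^ 2 / b := by
        rw [integral_sub (integrable_const _) (hindi.const_mul a), integral_const_mul a, hatom,
          integral_const, probReal_univ, one_smul]
        ring

end Truthful

/-! ### The second-price auction with a fixed reserve -/

section FixedReserve

variable {tie : Fin 2 → ℝ → ℝ → ℝ}

lemma IsTieBreaking.le_one (h : IsTieBreaking tie) (i : Fin 2) (r x : ℝ) : tie i r x ≤ 1 :=
  (Finset.single_le_sum (fun j _ => h.nonneg j r x) (Finset.mem_univ i)).trans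
    (h.sum_eq_one r x).le

lemma secondPriceAlloc_nonneg (h : IsTieBreaking tie) (r : ℝ) (v : Fin 2 → ℝ) (i : Fin 2) :
    0 ≤ secondPriceAlloc tie r v i := by
  unfold secondPriceAlloc
  have := h.nonneg i r (v i)
  split_ifs <;> simp [this]

lemma secondPriceAlloc_le_one (h : IsTieBreaking tie) (r : ℝ) (v : Fin 2 → ℝ) (i : Fin 2) :
    secondPriceAlloc tie r v i ≤ 1 := by
  unfold secondPriceAlloc
  have := h.le_one i r (v i)
  split_ifs <;> simp [this]

lemma sum_secondPriceAlloc_le_one (h : IsTieBreaking tie) (r : ℝ) (v : Fin 2 → ℝ) :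
    ∑ i, secondPriceAlloc tie r v i ≤ 1 := by
  have hs := h.sum_eq_one r (v 0)
  rw [Fin.sum_univ_two] at hs ⊢
  simp only [secondPriceAlloc, sub_zero, sub_self]
  rcases lt_trichotomy (v 0) (v 1) with h01 | h01 | h01
  · simp only [h01, h01.not_gt, if_true, if_false]
    split_ifs <;> norm_num
  · simp only [← h01, lt_irrefl, if_false]
    split_ifs
    · exact hs.le
    · norm_num
  · simp only [h01, h01.not_gt, if_true, if_false]
    split_ifs <;> norm_num

lemma measurable_secondPriceAlloc (h : IsTieBreaking tie) (i : Fin 2) :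
    Measurable fun p : (Fin 2 → ℝ) × ℝ => secondPriceAlloc tie p.2 p.1 i := by
  have hv : ∀ j : Fin 2, Measurable fun p : (Fin 2 → ℝ) × ℝ => p.1 j := fun j =>
    (measurable_pi_apply j).comp measurable_fst
  unfold secondPriceAlloc
  refine Measurable.ite (measurableSet_lt measurable_snd (hv i)) ?_ measurable_const
  refine Measurable.ite (measurableSet_lt (hv _) (hv i)) measurable_const ?_
  refine Measurable.ite (measurableSet_lt (hv i) (hv _)) measurable_const ?_
  exact (h.measurable i).comp (measurable_snd.prodMk (hv i))

lemma measurable_secondPricePay (h : IsTieBreaking tie) (i : Fin 2) :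
    Measurable fun p : (Fin 2 → ℝ) × ℝ => secondPricePay tie p.2 p.1 i :=
  (measurable_secondPriceAlloc h i).mul
    (measurable_snd.max ((measurable_pi_apply _).comp measurable_fst))

lemma one_sub_ne_self (i : Fin 2) : 1 - i ≠ i := by fin_cases i <;> decide

/-- The winner's price is the threshold `max r (v (1 - i))`. A bidder exactly at the threshold has
zero surplus whether winning or not, so the tie-breaking rule drops out. -/
lemma secondPrice_utility_eq (r : ℝ) (v : Fin 2 → ℝ) (i : Fin 2) :
    v i * secondPriceAlloc tie r v i - secondPricePay tie r v i =
      max (v i - max r (v (1 - i))) 0 := by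
  have e : v i * secondPriceAlloc tie r v i - secondPricePay tie r v i =
      secondPriceAlloc tie r v i * (v i - max r (v (1 - i))) := by
    rw [secondPricePay]; ring
  rw [e]
  rcases lt_trichotomy (v i) (max r (v (1 - i))) with h1 | h1 | h1
  · have : secondPriceAlloc tie r v i = 0 := by
      unfold secondPriceAlloc
      rcases lt_max_iff.1 h1 with h2 | h2
      · rw [if_neg h2.not_gt]
      · rw [if_neg h2.not_gt, if_pos h2, ite_self]
    rw [this, max_eq_right (sub_nonpos.2 h1.le), zero_mul]
  · rw [← h1]; simp
  · have h2 := max_lt_iff.1 h1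
    have : secondPriceAlloc tie r v i = 1 := by
      rw [secondPriceAlloc, if_pos h2.1, if_pos h2.2]
    rw [this, max_eq_left (sub_nonneg.2 h1.le), one_mul]

/-- The price does not depend on the bidder's own report; a report only selects a winning
probability in `[0, 1]`, and truth collects the positive part of the surplus. -/
lemma secondPrice_utility_update_le (h : IsTieBreaking tie) (r : ℝ) (v : Fin 2 → ℝ) (i : Fin 2)
    (d : ℝ) :
    v i * secondPriceAlloc tie r (Function.update v i d) i
        - secondPricePay tie r (Function.update v i d) i ≤
      v i * secondPriceAlloc tie r v i - secondPricePay tie r v i := by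
  rw [secondPrice_utility_eq, secondPricePay, Function.update_of_ne (one_sub_ne_self i)]
  set x := secondPriceAlloc tie r (Function.update v i d) i
  have h0 : 0 ≤ x := secondPriceAlloc_nonneg h _ _ _
  have h1 : x ≤ 1 := secondPriceAlloc_le_one h _ _ _
  calc v i * x - x * max r (v (1 - i)) = x * (v i - max r (v (1 - i))) := by ring
    _ ≤ x * max (v i - max r (v (1 - i))) 0 := by gcongr; exact le_max_left _ _
    _ ≤ _ := mul_le_of_le_one_left (le_max_right _ _) h1

/-- Indicator of the event that the value `w` exceeds the threshold `x`. -/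
def exceeds (x w : ℝ) : ℝ := if x < w then 1 else 0

lemma exceeds_nonneg (x w : ℝ) : 0 ≤ exceeds x w := by
  unfold exceeds; split_ifs <;> norm_num

lemma exceeds_le_one (x w : ℝ) : exceeds x w ≤ 1 := by
  unfold exceeds; split_ifs <;> norm_num

lemma measurable_exceeds : Measurable fun p : ℝ × ℝ => exceeds p.1 p.2 :=
  Measurable.ite (measurableSet_lt measurable_fst measurable_snd) measurable_const measurable_const

lemma exceeds_min (x w z : ℝ) : exceeds x (min w z) = exceeds x w * exceeds x z := by
  simp only [exceeds, lt_min_iff]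
  split_ifs <;> simp_all

/-- Revenue at a fixed reserve: the reserve is collected if some bid exceeds it, and in addition
the excess of the lower bid over the reserve. -/
lemma sum_secondPricePay (h : IsTieBreaking tie) (r : ℝ) (v : Fin 2 → ℝ) :
    ∑ i, secondPricePay tie r v i =
      r * (exceeds r (v 0) + exceeds r (v 1) - exceeds r (v 0) * exceeds r (v 1)) +
        max (min (v 0) (v 1) - r) 0 := by
  have hs := h.sum_eq_one r (v 0)
  rw [Fin.sum_univ_two] at hs ⊢
  simp only [secondPricePay, secondPriceAlloc, sub_zero, sub_self, exceeds]
  rcases lt_trichotomy (v 0) (v 1) with h01 | h01 | h01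
  · simp only [h01, h01.not_gt, if_true, if_false, min_eq_left h01.le, ite_self, zero_mul, zero_add]
    rcases lt_or_ge r (v 0) with hr | hr
    · simp only [hr, hr.trans h01, if_true]
      rw [max_eq_right hr.le, max_eq_left (by linarith)]; ring
    · simp only [hr.not_gt, if_false]
      rw [max_eq_left hr, max_eq_right (by linarith)]; ring
  · simp only [← h01, lt_irrefl, if_false, min_self]
    rcases lt_or_ge r (v 0) with hr | hr
    · simp only [hr, if_true]
      rw [← add_mul, hs, max_eq_right hr.le, max_eq_left (by linarith)]; ring
    · simp only [hr.not_gt, if_false]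
      rw [max_eq_right (sub_nonpos.2 hr)]; ring
  · simp only [h01, h01.not_gt, if_true, if_false, min_eq_right h01.le, ite_self, zero_mul,
      add_zero]
    rcases lt_or_ge r (v 1) with hr | hr
    · simp only [hr, hr.trans h01, if_true]
      rw [max_eq_right hr.le, max_eq_left (by linarith)]; ring
    · simp only [hr.not_gt, if_false]
      rw [max_eq_left hr, max_eq_right (by linarith)]; ring

end FixedReserve

/-! ### The random reserve and revenue by price level -/

section RandomReserve

variable {tie : Fin 2 → ℝ → ℝ → ℝ} {Q : ProbabilityMeasure ℝ} {b : ℝ}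

lemma integrable_secondPriceAlloc (h : IsTieBreaking tie) (v : Fin 2 → ℝ) (i : Fin 2) :
    Integrable (fun r => secondPriceAlloc tie r v i) (Q : Measure ℝ) :=
  Integrable.of_mem_Icc 0 1
    ((measurable_secondPriceAlloc h i).comp (measurable_const.prodMk measurable_id)).aemeasurable
    (Filter.Eventually.of_forall fun r =>
      ⟨secondPriceAlloc_nonneg h r v i, secondPriceAlloc_le_one h r v i⟩)

lemma integrable_secondPricePay (h : IsTieBreaking tie)
    (hQ : ∀ᵐ r ∂(Q : Measure ℝ), r ∈ Set.Icc 0 b) (v : Fin 2 → ℝ) (i : Fin 2) :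
    Integrable (fun r => secondPricePay tie r v i) (Q : Measure ℝ) := by
  refine Integrable.of_bound (C := b + |v (1 - i)|)
    ((measurable_secondPricePay h i).comp
      (measurable_const.prodMk measurable_id)).aestronglyMeasurable ?_
  filter_upwards [hQ] with r hr
  rw [secondPricePay, Real.norm_eq_abs, abs_mul,
    abs_of_nonneg (secondPriceAlloc_nonneg h r v i)]
  refine (mul_le_of_le_one_left (abs_nonneg _) (secondPriceAlloc_le_one h r v i)).trans ?_
  refine (abs_max_le_max_abs_abs).trans (max_le ?_ ?_)
  · rw [abs_of_nonneg hr.1]; linarith [hr.2, abs_nonneg (v (1 - i))]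
  · linarith [hr.1, hr.2]

lemma utility_secondPriceRandomReserve (h : IsTieBreaking tie)
    (hQ : ∀ᵐ r ∂(Q : Measure ℝ), r ∈ Set.Icc 0 b) (i : Fin 2) (w : ℝ) (v : Fin 2 → ℝ) :
    (secondPriceRandomReserve tie Q).utility i w v =
      ∫ r, (w * secondPriceAlloc tie r v i - secondPricePay tie r v i) ∂(Q : Measure ℝ) := by
  rw [integral_sub ((integrable_secondPriceAlloc h v i).const_mul w)
    (integrable_secondPricePay h hQ v i), integral_const_mul]
  rfl

lemma isTruthful_secondPriceRandomReserve (h : IsTieBreaking tie)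
    (hQ : ∀ᵐ r ∂(Q : Measure ℝ), r ∈ Set.Icc 0 b) :
    (secondPriceRandomReserve tie Q).IsTruthful b where
  measurable_alloc := measurable_pi_lambda _ fun i =>
    ((measurable_secondPriceAlloc h i).stronglyMeasurable.integral_prod_right
      (f := fun v r => secondPriceAlloc tie r v i)).measurable
  measurable_pay := measurable_pi_lambda _ fun i =>
    ((measurable_secondPricePay h i).stronglyMeasurable.integral_prod_right
      (f := fun v r => secondPricePay tie r v i)).measurable
  alloc_nonneg v _ i := integral_nonneg fun r => secondPriceAlloc_nonneg h r v i
  alloc_sum_le_one v _ := by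
    simp only [secondPriceRandomReserve]
    rw [← integral_finsetSum _ fun i _ => integrable_secondPriceAlloc h v i]
    calc ∫ r, ∑ i, secondPriceAlloc tie r v i ∂(Q : Measure ℝ) ≤ ∫ _, (1 : ℝ) ∂(Q : Measure ℝ) :=
          integral_mono (integrable_finsetSum _ fun i _ => integrable_secondPriceAlloc h v i)
            (integrable_const 1) fun r => sum_secondPriceAlloc_le_one h r v
      _ = 1 := by simp
  incentive_compatible v _ i d _ := by
    rw [utility_secondPriceRandomReserve h hQ, utility_secondPriceRandomReserve h hQ]
    exact integral_mono (((integrable_secondPriceAlloc h _ i).const_mul _).sub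
      (integrable_secondPricePay h hQ _ i)) (((integrable_secondPriceAlloc h _ i).const_mul _).sub
      (integrable_secondPricePay h hQ _ i)) fun r => secondPrice_utility_update_le h r v i d
  individually_rational v _ i := by
    rw [utility_secondPriceRandomReserve h hQ]
    refine integral_nonneg fun r => ?_
    rw [secondPrice_utility_eq]
    exact le_max_right _ _

lemma pay_secondPriceRandomReserve_nonneg (h : IsTieBreaking tie)
    (hQ : ∀ᵐ r ∂(Q : Measure ℝ), r ∈ Set.Icc 0 b) (v : Fin 2 → ℝ) (i : Fin 2) :
    0 ≤ (secondPriceRandomReserve tie Q).pay v i := by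
  refine integral_nonneg_of_ae ?_
  filter_upwards [hQ] with r hr
  exact mul_nonneg (secondPriceAlloc_nonneg h r v i) (hr.1.trans (le_max_left _ _))

/-- The product of the two indicators is the indicator of `[r, l)`, an interval of length `max (l -
r) 0`. -/
lemma integral_exceeds_mul_of_mem {l r : ℝ} (hl : l ∈ Set.Icc 0 b) (hr : r ∈ Set.Icc 0 b) :
    ∫ x in Set.Ioc 0 b, (Set.Iic x).indicator (fun _ => (1 : ℝ)) r * exceeds x l =
      max (l - r) 0 := by
  have : ∀ x, (Set.Iic x).indicator (fun _ => (1 : ℝ)) r * exceeds x l =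
      (Set.Ico r l).indicator (fun _ => (1 : ℝ)) x := by
    intro x
    simp only [Set.indicator_apply, exceeds, Set.mem_Iic, Set.mem_Ico]
    split_ifs <;> simp_all
  simp only [this]
  rw [← Measure.restrict_congr_set (Ico_ae_eq_Ioc (a := (0 : ℝ)) (b := b)),
    setIntegral_indicator measurableSet_Ico,
    Set.inter_eq_right.2 (Set.Ico_subset_Ico hr.1 hl.2)]
  simp

/-- Integration by parts against the distribution function. -/
lemma integral_max_sub_eq {l : ℝ} (hl : l ∈ Set.Icc 0 b)
    (hQ : ∀ᵐ r ∂(Q : Measure ℝ), r ∈ Set.Icc 0 b) :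
    ∫ r, max (l - r) 0 ∂(Q : Measure ℝ) =
      ∫ x in Set.Ioc 0 b, cdf (Q : Measure ℝ) x * exceeds x l := by
  calc ∫ r, max (l - r) 0 ∂(Q : Measure ℝ)
      = ∫ r, (∫ x in Set.Ioc 0 b, (Set.Iic x).indicator (fun _ => (1 : ℝ)) r * exceeds x l)
          ∂(Q : Measure ℝ) := by
        refine integral_congr_ae ?_
        filter_upwards [hQ] with r hr
        exact (integral_exceeds_mul_of_mem hl hr).symm
    _ = ∫ x in Set.Ioc 0 b, ∫ r, (Set.Iic x).indicator (fun _ => (1 : ℝ)) r * exceeds x l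
          ∂(Q : Measure ℝ) := by
        refine integral_integral_swap ?_
        refine Integrable.of_mem_Icc 0 1 (Measurable.aemeasurable ?_)
          (Filter.Eventually.of_forall fun p => ?_)
        · refine Measurable.mul ?_ (measurable_exceeds.comp (measurable_snd.prodMk measurable_const))
          have : (fun p : ℝ × ℝ => (Set.Iic p.2).indicator (fun _ => (1 : ℝ)) p.1) =
              fun p => if p.1 ≤ p.2 then 1 else 0 := by
            ext p; simp [Set.indicator_apply]
          rw [this]
          exact Measurable.ite (measurableSet_le measurable_fst measurable_snd) measurable_const
            measurable_const
        · simp only [Function.uncurry, Set.indicator_apply, exceeds]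
          split_ifs <;> norm_num
    _ = _ := by
        refine integral_congr_ae (Filter.Eventually.of_forall fun x => ?_)
        simp only
        rw [integral_mul_const, integral_indicator_const _ measurableSet_Iic, cdf_eq_real,
          smul_eq_mul, mul_one]

/-- The density of the random reserve, extended by zero. -/
def reserveDensityExt (a b x : ℝ) : ℝ := (Set.Ioc a b).indicator (reserveDensity a b) x

/-- The contribution of price level `x` to the revenue of the second-price auction with random
reserve, when the two indicators of exceeding `x` are `s` and `t`. -/
def levelRevenue (a b x s t : ℝ) : ℝ :=
  x * reserveDensityExt a b x * (s + t - s * t) + reserveCDF a b x * (s * t)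

lemma measurable_reserveDensityExt {a : ℝ} : Measurable (reserveDensityExt a b) :=
  measurable_reserveDensity.indicator measurableSet_Ioc

lemma measurable_reserveCDF {a : ℝ} (ha : 0 < a) (hab : a < b) : Measurable (reserveCDF a b) := by
  have := isProbabilityMeasure_reserveMeasure ha hab
  have h : reserveCDF a b = cdf (reserveMeasure a b) := by
    ext x; exact (cdf_reserveMeasure ha hab x).symm
  rw [h]
  exact (monotone_cdf _).measurable

lemma reserveCDF_mem {a : ℝ} (ha : 0 < a) (hab : a < b) (x : ℝ) :
    reserveCDF a b x ∈ Set.Icc 0 1 := by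
  have := isProbabilityMeasure_reserveMeasure ha hab
  rw [← cdf_reserveMeasure ha hab x]
  exact ⟨cdf_nonneg _ _, cdf_le_one _ _⟩

lemma integrableOn_mul_reserveDensityExt {a : ℝ} (ha : 0 < a) (hab : a < b) :
    IntegrableOn (fun x => x * reserveDensityExt a b x) (Set.Ioc 0 b) := by
  have h : IntegrableOn (reserveDensity a b) (Set.Ioc a b) :=
    intervalIntegral.integrableOn_deriv_of_nonneg (continuousOn_reserveBranch ha)
      (fun x hx => hasDerivAt_reserveBranch ha hx.1)
      fun x hx => reserveDensity_nonneg ha hab hx.1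
  have h2 : Integrable (reserveDensityExt a b) := h.integrable_indicator measurableSet_Ioc
  refine (h2.integrableOn (s := Set.Ioc 0 b)).bdd_mul (c := b)
    measurable_id.aestronglyMeasurable ?_
  filter_upwards [ae_restrict_mem measurableSet_Ioc] with x hx
  rw [Real.norm_eq_abs, abs_of_nonneg hx.1.le]
  exact hx.2

lemma integrableOn_levelRevenue {a : ℝ} (ha : 0 < a) (hab : a < b) {s t : ℝ → ℝ}
    (hs : Measurable s) (ht : Measurable t) (hs1 : ∀ x, s x ∈ Set.Icc 0 1)
    (ht1 : ∀ x, t x ∈ Set.Icc 0 1) :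
    IntegrableOn (fun x => x * reserveDensityExt a b x * (s x + t x - s x * t x)) (Set.Ioc 0 b) ∧
    IntegrableOn (fun x => reserveCDF a b x * (s x * t x)) (Set.Ioc 0 b) := by
  constructor
  · refine (integrableOn_mul_reserveDensityExt ha hab).mul_bdd (c := 2)
      ((hs.add ht).sub (hs.mul ht)).aestronglyMeasurable (Filter.Eventually.of_forall fun x => ?_)
    obtain ⟨h1, h2⟩ := hs1 x
    obtain ⟨h3, h4⟩ := ht1 x
    rw [Real.norm_eq_abs, abs_le]
    constructor <;> nlinarith [mul_nonneg h1 h3]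
  · refine Integrable.of_mem_Icc 0 1
      ((measurable_reserveCDF ha hab).mul (hs.mul ht)).aemeasurable
      (Filter.Eventually.of_forall fun x => ?_)
    obtain ⟨h1, h2⟩ := hs1 x
    obtain ⟨h3, h4⟩ := ht1 x
    obtain ⟨h5, h6⟩ := reserveCDF_mem ha hab x
    exact ⟨by positivity, mul_le_one₀ h6 (by positivity) (mul_le_one₀ h2 h3 h4)⟩

/-- Collected reserves integrate against the density of `Q` alone, because its atom sits at reserve
0 and earns nothing. The excess of the lower bid becomes an integral of the distribution function by
integration by parts. -/
lemma sum_pay_eq_integral_levelRevenue {a : ℝ} (ha : 0 < a) (hab : a < b) (h : IsTieBreaking tie)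
    (hQ : (Q : Measure ℝ) = reserveMeasure a b) {v : Fin 2 → ℝ} (hv : v ∈ profiles b) :
    ∑ i, (secondPriceRandomReserve tie Q).pay v i =
      ∫ x in Set.Ioc 0 b, levelRevenue a b x (exceeds x (v 0)) (exceeds x (v 1)) := by
  have hQae : ∀ᵐ r ∂(Q : Measure ℝ), r ∈ Set.Icc 0 b := by
    rw [hQ]; exact ae_mem_reserveMeasure ha hab
  have hm : ∀ w, Measurable fun x => exceeds x w := fun w =>
    measurable_exceeds.comp (measurable_id.prodMk measurable_const)
  have hmin : min (v 0) (v 1) ∈ Set.Icc 0 b :=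
    ⟨le_min (hv 0).1 (hv 1).1, (min_le_left _ _).trans (hv 0).2⟩
  have hI := integrableOn_levelRevenue ha hab (hm (v 0)) (hm (v 1))
    (fun x => ⟨exceeds_nonneg _ _, exceeds_le_one _ _⟩)
    (fun x => ⟨exceeds_nonneg _ _, exceeds_le_one _ _⟩)
  set E : ℝ → ℝ := fun r => exceeds r (v 0) + exceeds r (v 1) - exceeds r (v 0) * exceeds r (v 1)
    with hE
  have hEm : Measurable E := ((hm _).add (hm _)).sub ((hm _).mul (hm _))
  have hEb : ∀ r, E r ∈ Set.Icc 0 1 := by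
    intro r
    simp only [hE, exceeds]
    split_ifs <;> norm_num
  have hi1 : Integrable (fun r => r * E r) (Q : Measure ℝ) := by
    refine Integrable.of_mem_Icc 0 b (measurable_id.mul hEm).aemeasurable ?_
    filter_upwards [hQae] with r hr
    exact ⟨mul_nonneg hr.1 (hEb r).1, (mul_le_of_le_one_right hr.1 (hEb r).2).trans hr.2⟩
  have hi2 : Integrable (fun r => max (min (v 0) (v 1) - r) 0) (Q : Measure ℝ) := by
    refine Integrable.of_mem_Icc 0 b (by fun_prop) ?_
    filter_upwards [hQae] with r hr
    exact ⟨le_max_right _ _, max_le (by linarith [hmin.2, hr.1]) (hr.1.trans hr.2)⟩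
  have h1 : ∫ r, r * E r ∂(Q : Measure ℝ) =
      ∫ x in Set.Ioc 0 b, x * reserveDensityExt a b x * E x := by
    rw [hQ] at hi1 ⊢
    rw [reserveMeasure, (integral_atomPlusDensity (reserveAtom_nonneg ha hab)
      measurable_reserveDensity (fun x hx => reserveDensity_nonneg ha hab hx.1) hi1).2, zero_mul,
      mul_zero, zero_add]
    have : ∀ x, x * reserveDensityExt a b x * E x =
        (Set.Ioc a b).indicator (fun x => reserveDensity a b x * (x * E x)) x := by
      intro x
      simp only [reserveDensityExt, Set.indicator_apply]
      split_ifs <;> ring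
    simp only [this]
    rw [setIntegral_indicator measurableSet_Ioc,
      Set.inter_eq_right.2 (Set.Ioc_subset_Ioc_left ha.le)]
  have h2 := integral_max_sub_eq hmin hQae
  simp only [secondPriceRandomReserve]
  rw [← integral_finsetSum _ fun i _ => integrable_secondPricePay h hQae v i]
  simp only [sum_secondPricePay h, levelRevenue]
  rw [integral_add hi1 hi2, h1, h2, integral_add hI.1 hI.2, hQ]
  simp only [exceeds_min, cdf_reserveMeasure ha hab, hE]

end RandomReserve

/-! ### Tails and expectation over i.i.d. values -/

/-- The probability that a value drawn from `μ` exceeds `x`. -/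
def tail (μ : Measure ℝ) (x : ℝ) : ℝ := μ.real (Set.Ioi x)

section Tail

lemma integral_exceeds (μ : Measure ℝ) (x : ℝ) : ∫ w, exceeds x w ∂μ = tail μ x := by
  have : ∀ w, exceeds x w = (Set.Ioi x).indicator (fun _ => (1 : ℝ)) w := fun w => by
    simp [exceeds, Set.indicator_apply]
  simp only [this]
  rw [integral_indicator_const _ measurableSet_Ioi, smul_eq_mul, mul_one, tail]

variable {μ : Measure ℝ} [IsProbabilityMeasure μ] {a b : ℝ}

lemma tail_eq_one_sub_cdf (x : ℝ) : tail μ x = 1 - cdf μ x := by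
  rw [tail, cdf_eq_real, ← Set.compl_Iic, probReal_compl_eq_one_sub measurableSet_Iic]

lemma measurable_tail : Measurable (tail μ) := by
  have : tail μ = fun x => 1 - cdf μ x := funext tail_eq_one_sub_cdf
  rw [this]
  exact measurable_const.sub (monotone_cdf μ).measurable

lemma tail_mem (x : ℝ) : tail μ x ∈ Set.Icc 0 1 := ⟨measureReal_nonneg, measureReal_le_one⟩

lemma integrableOn_tail : IntegrableOn (tail μ) (Set.Ioc 0 b) :=
  Integrable.of_mem_Icc 0 1 measurable_tail.aemeasurable (Filter.Eventually.of_forall tail_mem)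

/-- Layer-cake formula, cut at `b` since the tail vanishes above it. The mean constraint becomes
linear in the tail. -/
lemma integral_id_eq_integral_tail (hμ : ∀ᵐ v ∂μ, v ∈ Set.Icc 0 b) :
    ∫ v, v ∂μ = ∫ x in Set.Ioc 0 b, tail μ x := by
  have hi : Integrable (fun v : ℝ => v) μ := Integrable.of_mem_Icc 0 b aemeasurable_id hμ
  rw [hi.integral_eq_integral_meas_lt (hμ.mono fun v hv => hv.1)]
  refine (setIntegral_eq_of_subset_of_forall_sdiff_eq_zero measurableSet_Ioi
    Set.Ioc_subset_Ioi_self fun x hx => ?_)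
  have hxb : b < x := by
    by_contra hc
    exact hx.2 ⟨hx.1, not_lt.1 hc⟩
  rw [measureReal_eq_zero_iff, ← nonpos_iff_eq_zero, ← show μ (Set.Icc 0 b)ᶜ = 0 from hμ]
  exact measure_mono fun v hv hv' => absurd (hv'.2.trans_lt hxb) (not_lt.2 (le_of_lt hv))

lemma integrable_levelRevenue_exceeds (ha : 0 < a) (hab : a < b) (P : Measure (Fin 2 → ℝ))
    [IsProbabilityMeasure P] :
    Integrable (Function.uncurry fun (v : Fin 2 → ℝ) x =>
      levelRevenue a b x (exceeds x (v 0)) (exceeds x (v 1)))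
      (P.prod (volume.restrict (Set.Ioc 0 b))) := by
  have hg : Integrable (fun x => |x * reserveDensityExt a b x| + 1)
      (volume.restrict (Set.Ioc 0 b)) :=
    (integrableOn_mul_reserveDensityExt ha hab).abs.add (integrable_const 1)
  have he : ∀ i : Fin 2, Measurable fun p : (Fin 2 → ℝ) × ℝ => exceeds p.2 (p.1 i) := fun i =>
    measurable_exceeds.comp
      (measurable_snd.prodMk ((measurable_pi_apply i).comp measurable_fst))
  refine (hg.comp_snd P).mono' (Measurable.aestronglyMeasurable ?_)
    (Filter.Eventually.of_forall fun p => ?_)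
  · exact ((measurable_snd.mul (measurable_reserveDensityExt.comp measurable_snd)).mul
      (((he 0).add (he 1)).sub ((he 0).mul (he 1)))).add
      (((measurable_reserveCDF ha hab).comp measurable_snd).mul ((he 0).mul (he 1)))
  · obtain ⟨v, x⟩ := p
    simp only [Function.uncurry, levelRevenue, Real.norm_eq_abs]
    refine (abs_add_le _ _).trans (add_le_add ?_ ?_)
    · rw [abs_mul]
      refine mul_le_of_le_one_right (abs_nonneg _) ?_
      simp only [exceeds]
      split_ifs <;> norm_num
    · obtain ⟨h5, h6⟩ := reserveCDF_mem ha hab x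
      rw [abs_mul, abs_of_nonneg h5]
      refine mul_le_one₀ h6 (abs_nonneg _) ?_
      simp only [exceeds]
      split_ifs <;> norm_num

/-- `levelRevenue` is affine in each of the two indicators, so by independence each may be replaced
by its expectation. -/
lemma integral_levelRevenue_exceeds (x : ℝ) :
    ∫ v, levelRevenue a b x (exceeds x (v 0)) (exceeds x (v 1)) ∂(Measure.pi fun _ : Fin 2 => μ) =
      levelRevenue a b x (tail μ x) (tail μ x) := by
  have hm : Measurable (exceeds x) := measurable_exceeds.comp (measurable_const.prodMk measurable_id)
  have hi : Integrable (exceeds x) μ := Integrable.of_mem_Icc 0 1 hm.aemeasurable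
    (Filter.Eventually.of_forall fun w => ⟨exceeds_nonneg _ _, exceeds_le_one _ _⟩)
  have h0 : Integrable (fun z : ℝ × ℝ => exceeds x z.1) (μ.prod μ) := hi.comp_fst μ
  have h1 : Integrable (fun z : ℝ × ℝ => exceeds x z.2) (μ.prod μ) := hi.comp_snd μ
  have h01 : Integrable (fun z : ℝ × ℝ => exceeds x z.1 * exceeds x z.2) (μ.prod μ) :=
    hi.mul_prod hi
  have hadd : Integrable (fun z : ℝ × ℝ => exceeds x z.1 + exceeds x z.2) (μ.prod μ) := h0.add h1
  have hsub : Integrable (fun z : ℝ × ℝ =>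
      exceeds x z.1 + exceeds x z.2 - exceeds x z.1 * exceeds x z.2) (μ.prod μ) := hadd.sub h01
  rw [integral_pi_two]
  simp only [levelRevenue, Matrix.cons_val_zero, Matrix.cons_val_one]
  rw [integral_add (hsub.const_mul _) (h01.const_mul _), integral_const_mul,
    integral_const_mul, integral_sub hadd h01, integral_add h0 h1, integral_fun_fst,
    integral_fun_snd, integral_prod_mul (exceeds x) (exceeds x), integral_exceeds]
  simp

end Tail

/-! ### The adversary's best response and the value of the game -/

section Revenue

variable {tie : Fin 2 → ℝ → ℝ → ℝ} {Q F : ProbabilityMeasure ℝ} {a b : ℝ}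

lemma revenue_secondPriceRandomReserve (ha : 0 < a) (hab : a < b) (h : IsTieBreaking tie)
    (hQ : (Q : Measure ℝ) = reserveMeasure a b)
    (hF : ∀ᵐ v ∂(F : Measure ℝ), v ∈ Set.Icc 0 b) :
    revenue F (secondPriceRandomReserve tie Q) =
      ((∫ x in Set.Ioc 0 b,
        levelRevenue a b x (tail (F : Measure ℝ) x) (tail (F : Measure ℝ) x) : ℝ) : EReal) := by
  have hQae : ∀ᵐ r ∂(Q : Measure ℝ), r ∈ Set.Icc 0 b := by
    rw [hQ]; exact ae_mem_reserveMeasure ha hab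
  have hM := isTruthful_secondPriceRandomReserve h hQae
  have hS : Integrable (fun v => ∑ i, (secondPriceRandomReserve tie Q).pay v i)
      (Measure.pi fun _ : Fin 2 => (F : Measure ℝ)) := by
    refine integrable_finsetSum _ fun i _ =>
      Integrable.of_mem_Icc 0 b (hM.measurable_pay_apply i).aemeasurable ?_
    filter_upwards [ae_pi_two hF] with v hv
    exact ⟨pay_secondPriceRandomReserve_nonneg h hQae v i, hM.pay_le hv i⟩
  rw [revenue_eq_integral hS]
  congr 1
  calc ∫ v, ∑ i, (secondPriceRandomReserve tie Q).pay v i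
        ∂(Measure.pi fun _ : Fin 2 => (F : Measure ℝ))
      = ∫ v, (∫ x in Set.Ioc 0 b, levelRevenue a b x (exceeds x (v 0)) (exceeds x (v 1)))
        ∂(Measure.pi fun _ : Fin 2 => (F : Measure ℝ)) := by
        refine integral_congr_ae ?_
        filter_upwards [ae_pi_two hF] with v hv
        exact sum_pay_eq_integral_levelRevenue ha hab h hQ hv
    _ = _ := by
        rw [integral_integral_swap (integrable_levelRevenue_exceeds ha hab _)]
        simp only [integral_levelRevenue_exceeds]

lemma integrableOn_levelRevenue_tail (ha : 0 < a) (hab : a < b) (μ : Measure ℝ)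
    [IsProbabilityMeasure μ] :
    IntegrableOn (fun x => levelRevenue a b x (tail μ x) (tail μ x)) (Set.Ioc 0 b) :=
  have h := integrableOn_levelRevenue (b := b) ha hab (measurable_tail (μ := μ))
    (measurable_tail (μ := μ)) tail_mem tail_mem
  h.1.add h.2

lemma tail_equalRevenueMeasure_of_le (ha : 0 < a) (hab : a < b) {x : ℝ} (hx : x ≤ a) :
    tail (equalRevenueMeasure a b) x = 1 := by
  have := isProbabilityMeasure_equalRevenueMeasure ha hab
  rw [tail_eq_one_sub_cdf, cdf_equalRevenueMeasure ha hab, equalRevenueCDF]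
  rcases hx.lt_or_eq with h | rfl
  · rw [if_pos h, sub_zero]
  · rw [if_neg (lt_irrefl _), if_pos hab, div_self ha.ne']; ring

lemma tail_equalRevenueMeasure_of_mem (ha : 0 < a) {x : ℝ} (hx : x ∈ Set.Ioo a b) :
    tail (equalRevenueMeasure a b) x = a / x := by
  have hab := hx.1.trans hx.2
  have := isProbabilityMeasure_equalRevenueMeasure ha hab
  rw [tail_eq_one_sub_cdf, cdf_equalRevenueMeasure ha hab, equalRevenueCDF,
    if_neg hx.1.not_gt, if_pos hx.2]
  ring

lemma levelRevenue_of_le {x : ℝ} (h0 : 0 ≤ x) (hx : x ≤ a) (s t : ℝ) :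
    levelRevenue a b x s t = reserveAtom a b * (s * t) := by
  rw [levelRevenue, reserveDensityExt, Set.indicator_of_notMem (fun h => h.1.not_ge hx),
    reserveCDF_of_le h0 hx]
  ring

lemma levelRevenue_of_mem (ha : 0 < a) {x : ℝ} (hx : x ∈ Set.Ioc a b) (s t : ℝ) :
    levelRevenue a b x s t =
      x * reserveDensity a b x * (s + t - s * t) + reserveBranch a b x * (s * t) := by
  rw [levelRevenue, reserveDensityExt, Set.indicator_of_mem hx,
    reserveCDF_of_mem ha ⟨hx.1.le, hx.2⟩]

/-- The first-order condition that makes the equal-revenue distribution a best response. -/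
lemma reserve_first_order (ha : 0 < a) {x : ℝ} (hx : a < x) :
    x * reserveDensity a b x * (1 - a / x) + reserveBranch a b x * (a / x) = reserveAtom a b := by
  have hx0 : x ≠ 0 := (ha.trans hx).ne'
  have hxa : x - a ≠ 0 := (sub_pos.2 hx).ne'
  rw [reserveBranch_of_lt hx, reserveDensity]
  field_simp
  ring

/-- Pointwise optimality of the tail of the equal-revenue distribution in the Lagrangian. -/
lemma levelRevenue_tail_equalRevenueMeasure_le (ha : 0 < a) {x : ℝ} (hx : x ∈ Set.Ioo 0 b)
    (hab : a < b) (s : ℝ) :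
    levelRevenue a b x (tail (equalRevenueMeasure a b) x) (tail (equalRevenueMeasure a b) x)
        - 2 * reserveAtom a b * tail (equalRevenueMeasure a b) x ≤
      levelRevenue a b x s s - 2 * reserveAtom a b * s := by
  have hC := reserveAtom_nonneg ha hab
  rcases le_or_gt x a with h | h
  · rw [tail_equalRevenueMeasure_of_le ha hab h, levelRevenue_of_le hx.1.le h,
      levelRevenue_of_le hx.1.le h]
    -- Below `a` the difference of the two sides is exactly `C * (s - 1) ^ 2`.
    linarith [mul_nonneg hC (sq_nonneg (s - 1))]
  · have hxm : x ∈ Set.Ioc a b := ⟨h, hx.2.le⟩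
    rw [tail_equalRevenueMeasure_of_mem ha ⟨h, hx.2⟩, levelRevenue_of_mem ha hxm,
      levelRevenue_of_mem ha hxm]
    have hfo := reserve_first_order (b := b) ha h
    have hQC : reserveAtom a b ≤ reserveBranch a b x := by
      rw [← reserveBranch_left (b := b) ha]
      exact reserveBranch_monotoneOn ha hab ⟨le_rfl, hab.le⟩ ⟨h.le, hx.2.le⟩ h.le
    have hp : 0 < 1 - a / x := sub_pos.2 ((div_lt_one hx.1).2 h)
    set A := x * reserveDensity a b x
    set q := reserveBranch a b x
    set p := a / x
    -- The first-order condition gives `A * (1 - p) + q * p = C ≤ q`, hence `A * (1 - p) ≤ q * (1 -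
    -- p)`: the quadratic in `s` is convex.
    have hAq : A ≤ q := by
      refine le_of_mul_le_mul_right ?_ hp
      linarith
    rw [← hfo]
    -- With `C` replaced through the first-order condition, completing the square leaves the
    -- difference `(q - A) * (s - p) ^ 2`.
    linarith [mul_nonneg (sub_nonneg.2 hAq) (sq_nonneg (s - p))]

lemma ae_mem_Ioo_of_Ioc : ∀ᵐ x ∂(volume.restrict (Set.Ioc 0 b)), x ∈ Set.Ioo 0 b := by
  rw [← Measure.restrict_congr_set Ioo_ae_eq_Ioc]
  exact ae_restrict_mem measurableSet_Ioo

lemma integral_levelRevenue_tail_le (ha : 0 < a) (hab : a < b) {μ : Measure ℝ}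
    [IsProbabilityMeasure μ] (hμ : ∀ᵐ v ∂μ, v ∈ Set.Icc 0 b)
    (hmean : ∫ v, v ∂μ = ∫ v, v ∂(equalRevenueMeasure a b)) :
    ∫ x in Set.Ioc 0 b, levelRevenue a b x (tail (equalRevenueMeasure a b) x)
        (tail (equalRevenueMeasure a b) x) ≤
      ∫ x in Set.Ioc 0 b, levelRevenue a b x (tail μ x) (tail μ x) := by
  have := isProbabilityMeasure_equalRevenueMeasure ha hab
  have hν : ∀ᵐ v ∂(equalRevenueMeasure a b), v ∈ Set.Icc 0 b :=
    (ae_mem_equalRevenueMeasure hab).mono fun v hv => ⟨ha.le.trans hv.1, hv.2⟩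
  rw [integral_id_eq_integral_tail hμ, integral_id_eq_integral_tail hν] at hmean
  have hI1 := integrableOn_levelRevenue_tail ha hab (equalRevenueMeasure a b)
  have hI2 := integrableOn_levelRevenue_tail ha hab μ
  have hT1 := (integrableOn_tail (μ := equalRevenueMeasure a b) (b := b)).const_mul
    (2 * reserveAtom a b)
  have hT2 := (integrableOn_tail (μ := μ) (b := b)).const_mul (2 * reserveAtom a b)
  -- Equal means give equal integrals of the tails, so the multiplier terms cancel after
  -- integration.
  have key := integral_mono_ae (hI1.sub hT1) (hI2.sub hT2) (by
    filter_upwards [ae_mem_Ioo_of_Ioc] with x hx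
    exact levelRevenue_tail_equalRevenueMeasure_le ha hx hab (tail μ x))
  simp only [Pi.sub_apply] at key
  rw [integral_sub hI1 hT1, integral_sub hI2 hT2, integral_const_mul, integral_const_mul,
    hmean] at key
  linarith

/-- The value of the game. -/
lemma integral_levelRevenue_tail_equalRevenueMeasure (ha : 0 < a) (hab : a < b) :
    ∫ x in Set.Ioc 0 b, levelRevenue a b x (tail (equalRevenueMeasure a b) x)
        (tail (equalRevenueMeasure a b) x) = 2 * a - a ^ 2 / b := by
  have := isProbabilityMeasure_equalRevenueMeasure ha hab
  have hb := ha.trans hab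
  have hI := integrableOn_levelRevenue_tail ha hab (equalRevenueMeasure a b)
  have hI2 := hI.mono_set (Set.Ioc_subset_Ioc_left ha.le)
  rw [← Set.Ioc_union_Ioc_eq_Ioc ha.le hab.le,
    setIntegral_union (Set.Ioc_disjoint_Ioc_of_le le_rfl) measurableSet_Ioc
      (hI.mono_set (Set.Ioc_subset_Ioc_right hab.le)) hI2]
  have h1 : ∫ x in Set.Ioc 0 a, levelRevenue a b x (tail (equalRevenueMeasure a b) x)
        (tail (equalRevenueMeasure a b) x) = a * reserveAtom a b := by
    rw [setIntegral_congr_fun (g := fun _ => reserveAtom a b) measurableSet_Ioc]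
    · simp [ha.le]
    · intro x hx
      simp only
      rw [tail_equalRevenueMeasure_of_le ha hab hx.2, levelRevenue_of_le hx.1.le hx.2]
      ring
  -- At tail `a / x` the integrand is `2 * a * q - a ^ 2 * (q / x - Q / x ^ 2)`, and the bracket is
  -- the derivative of `Q / x`.
  set W : ℝ → ℝ := fun x => 2 * a * reserveBranch a b x - a ^ 2 * (reserveBranch a b x / x) with hW
  have hcont : ContinuousOn W (Set.Icc a b) :=
    (continuousOn_const.mul (continuousOn_reserveBranch ha)).sub
      (continuousOn_const.mul ((continuousOn_reserveBranch ha).div continuousOn_id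
        fun x hx => (ha.trans_le hx.1).ne'))
  have hderiv : ∀ x ∈ Set.Ioo a b, HasDerivAt W
      (levelRevenue a b x (tail (equalRevenueMeasure a b) x)
        (tail (equalRevenueMeasure a b) x)) x := by
    intro x hx
    have hx0 : x ≠ 0 := (ha.trans hx.1).ne'
    have hR := hasDerivAt_reserveBranch (b := b) ha hx.1
    refine ((hR.const_mul (2 * a)).sub ((hR.div (hasDerivAt_id x) hx0).const_mul
      (a ^ 2))).congr_deriv ?_
    rw [tail_equalRevenueMeasure_of_mem ha hx, levelRevenue_of_mem ha ⟨hx.1, hx.2.le⟩]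
    simp only [id]
    field_simp
    ring
  have h2 := intervalIntegral.integral_eq_sub_of_hasDerivAt_of_le hab.le hcont hderiv
    ((intervalIntegrable_iff_integrableOn_Ioc_of_le hab.le).2 hI2)
  rw [intervalIntegral.integral_of_le hab.le] at h2
  rw [h1, h2, hW]
  simp only [reserveBranch_left ha, reserveBranch_right ha hab]
  field_simp
  ring

end Revenue

/-! ### The equation for the lower end of the support -/

section Root

/-- The left side extends continuously by 0 at 0, equals `b` at `b`, and has derivative `log b - log
a > 0` in between. -/
lemma existsUnique_vlow {m b : ℝ} (hm : 0 < m) (hmb : m < b) :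
    ∃! a : ℝ, a ∈ Set.Ioc 0 b ∧ a * (1 + Real.log b - Real.log a) = m := by
  have hb := hm.trans hmb
  set g : ℝ → ℝ := fun x => (1 + Real.log b) * x - x * Real.log x with hg
  have heq : ∀ x, x * (1 + Real.log b - Real.log x) = g x := fun x => by simp only [hg]; ring
  have hcont : Continuous g := (continuous_const.mul continuous_id).sub Real.continuous_mul_log
  have hmono : StrictMonoOn g (Set.Icc 0 b) := by
    refine strictMonoOn_of_deriv_pos (convex_Icc 0 b) hcont.continuousOn fun x hx => ?_
    rw [interior_Icc] at hx
    have hd : HasDerivAt g ((1 + Real.log b) * 1 - (Real.log x + 1)) x :=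
      ((hasDerivAt_id x).const_mul (1 + Real.log b)).sub (Real.hasDerivAt_mul_log hx.1.ne')
    rw [hd.deriv]
    linarith [Real.log_lt_log hx.1 hx.2]
  have hg0 : g 0 = 0 := by simp [hg]
  have hgb : g b = b := by simp only [hg]; ring
  obtain ⟨a, ha, hga⟩ := intermediate_value_Icc hb.le hcont.continuousOn
    (show m ∈ Set.Icc (g 0) (g b) by rw [hg0, hgb]; exact ⟨hm.le, hmb.le⟩)
  have ha0 : 0 < a := by
    refine lt_of_le_of_ne ha.1 ?_
    rintro rfl
    rw [hg0] at hga
    exact hm.ne hga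
  refine ⟨a, ⟨⟨ha0, ha.2⟩, (heq a).trans hga⟩, ?_⟩
  rintro y ⟨hy, hgy⟩
  rw [heq] at hgy
  exact hmono.injOn ⟨hy.1.le, hy.2⟩ ha (hgy.trans hga.symm)

end Root

/-! ### From the saddle point to maximin and minimax -/

section Saddle

variable {m b : ℝ} {M : Mechanism} {F : ProbabilityMeasure ℝ}

lemma IsEquilibrium.isMaxOn (h : IsEquilibrium m b M F) :
    IsMaxOn (fun M => ⨅ F ∈ compatibleDistributions m b, revenue F M) (truthfulMechanisms b) M :=
  isMaxOn_iff.2 fun M' hM' => (iInf₂_le F h.distribution_mem).trans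
    ((h.seller_optimal M' hM').trans (le_iInf₂ h.adversary_optimal))

lemma IsEquilibrium.isMinOn (h : IsEquilibrium m b M F) :
    IsMinOn (fun F => ⨆ M ∈ truthfulMechanisms b, revenue F M) (compatibleDistributions m b) F :=
  isMinOn_iff.2 fun F' hF' => (iSup₂_le h.seller_optimal).trans
    ((h.adversary_optimal F' hF').trans
      (le_iSup₂ (f := fun M (_ : M ∈ truthfulMechanisms b) => revenue F' M) M h.mechanism_mem))

end Saddle

lemma isEquilibrium_secondPriceRandomReserve {a b : ℝ} (ha : 0 < a) (hab : a < b)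
    {F Q : ProbabilityMeasure ℝ} (hF : (F : Measure ℝ) = equalRevenueMeasure a b)
    (hQ : (Q : Measure ℝ) = reserveMeasure a b) {tie : Fin 2 → ℝ → ℝ → ℝ}
    (h : IsTieBreaking tie) :
    IsEquilibrium (a * (1 + Real.log b - Real.log a)) b (secondPriceRandomReserve tie Q) F := by
  have hFae : ∀ᵐ v ∂(F : Measure ℝ), v ∈ Set.Icc 0 b := by
    rw [hF]
    exact (ae_mem_equalRevenueMeasure hab).mono fun v hv => ⟨ha.le.trans hv.1, hv.2⟩
  have hrev := revenue_secondPriceRandomReserve ha hab h hQ hFae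
  rw [hF] at hrev
  refine ⟨?_, ⟨hFae, ?_⟩, fun M' hM' => ?_, fun F' hF' => ?_⟩
  · refine isTruthful_secondPriceRandomReserve h ?_
    rw [hQ]
    exact ae_mem_reserveMeasure ha hab
  · rw [hF]; exact integral_id_equalRevenueMeasure ha hab
  · rw [hrev, integral_levelRevenue_tail_equalRevenueMeasure ha hab]
    exact hM'.revenue_equalRevenueMeasure_le ha hab hF
  · rw [hrev, revenue_secondPriceRandomReserve ha hab h hQ hF'.1, EReal.coe_le_coe_iff]
    exact integral_levelRevenue_tail_le ha hab hF'.1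
      (hF'.2.trans (integral_id_equalRevenueMeasure ha hab).symm)

end RobustAuction

end

theorem theorem2 (m vbar : ℝ) (hm : 0 < m) (hmv : m < vbar) :
    (∃! vlow : ℝ, vlow ∈ Set.Ioc 0 vbar ∧
      vlow * (1 + Real.log vbar - Real.log vlow) = m) ∧
    ∀ vlow : ℝ, vlow ∈ Set.Ioc 0 vbar →
      vlow * (1 + Real.log vbar - Real.log vlow) = m →
      ∃ Fstar Qstar : MeasureTheory.ProbabilityMeasure ℝ,
        (∀ v, ProbabilityTheory.cdf (Fstar : MeasureTheory.Measure ℝ) v =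
          RobustAuction.equalRevenueCDF vlow vbar v) ∧
        (∀ r, ProbabilityTheory.cdf (Qstar : MeasureTheory.Measure ℝ) r =
          RobustAuction.reserveCDF vlow vbar r) ∧
        Qstar ∈ RobustAuction.supportedDistributions vbar ∧
        ∀ tie : Fin 2 → ℝ → ℝ → ℝ, RobustAuction.IsTieBreaking tie →
          RobustAuction.IsEquilibrium m vbar
            (RobustAuction.secondPriceRandomReserve tie Qstar) Fstar ∧
          IsMaxOn
            (fun M => ⨅ F ∈ RobustAuction.compatibleDistributions m vbar,
              RobustAuction.revenue F M)
            (RobustAuction.truthfulMechanisms vbar)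
            (RobustAuction.secondPriceRandomReserve tie Qstar) ∧
          IsMinOn
            (fun F => ⨆ M ∈ RobustAuction.truthfulMechanisms vbar,
              RobustAuction.revenue F M)
            (RobustAuction.compatibleDistributions m vbar)
            Fstar := by
  refine ⟨RobustAuction.existsUnique_vlow hm hmv, fun a ha hmean => ?_⟩
  -- If `a = vbar`, the equation would force the mean to be `vbar`.
  have hab : a < vbar := by
    refine lt_of_le_of_ne ha.2 ?_
    rintro rfl
    rw [add_sub_cancel_right, mul_one] at hmean
    exact hmv.ne hmean.symm
  refine ⟨⟨RobustAuction.equalRevenueMeasure a vbar,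
      RobustAuction.isProbabilityMeasure_equalRevenueMeasure ha.1 hab⟩,
    ⟨RobustAuction.reserveMeasure a vbar,
      RobustAuction.isProbabilityMeasure_reserveMeasure ha.1 hab⟩,
    RobustAuction.cdf_equalRevenueMeasure ha.1 hab, RobustAuction.cdf_reserveMeasure ha.1 hab,
    RobustAuction.ae_mem_reserveMeasure ha.1 hab, fun tie htie => ?_⟩
  have heq := RobustAuction.isEquilibrium_secondPriceRandomReserve ha.1 hab
    (F := ⟨RobustAuction.equalRevenueMeasure a vbar,
      RobustAuction.isProbabilityMeasure_equalRevenueMeasure ha.1 hab⟩)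
    (Q := ⟨RobustAuction.reserveMeasure a vbar,
      RobustAuction.isProbabilityMeasure_reserveMeasure ha.1 hab⟩) rfl rfl htie
  rw [hmean] at heq
  exact ⟨heq, heq.isMaxOn, heq.isMinOn⟩
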